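/- All registers are finite-dimensional. For a register $A$ write $A^m$ for $m$ copies of it, and let $\pi\in S_m$ act on $\mathcal H_A^{\otimes m}$ by $\pi(|\phi_1\rangle\otimes\dots\otimes|\phi_m\rangle)=|\phi_{\pi^{-1}(1)}\rangle\otimes\dots\otimes|\phi_{\pi^{-1}(m)}\rangle$. Let $\mathrm{Sym}^m(\mathcal H)$ be the space of vectors of $\mathcal H^{\otimes m}$ fixed by all $\pi\in S_m$. Let $\|A\|_1=\mathrm{tr}\sqrt{A^\dagger A}$ and $F(\rho,\sigma)=\|\sqrt\rho\sqrt\sigma\|_1$. **EPR-LOCC Sampling.** Let $N=n+k$, let $S$ be a qubit and let $\varphi_S=\mathrm{id}/2$ be the reference state (half of an EPR pair). Paul prepares a state $\rho_{RS^N}$ and sends $S^N$ to Sam. Sam chooses a subset $t\subseteq[N]$ of size $k$ and a string of bases $c\in\{+,\times\}^k$ (computational or diagonal), both uniformly at random, and sends $(t,c)$ to Paul. Paul answers with a string $\hat X\in\{0,1\}^k$. (An honest Paul prepares $N$ EPR pairs and answers with the outcomes of measuring his halves at the positions of $t$ in the bases $c$; in general, he applies an arbitrary quantum operation, depending on $t$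 and $c$, to $R$.) Sam measures his qubits at the positions of $t$ in the bases $c$, and accepts if and only if his outcome $X\in\{0,1\}^k$ equals $\hat X$. For a strategy of Paul let $\mathcal E^{\mathrm{acc}}_{RS^N\to S^n}$ be the map that sends $\rho_{RS^N}$ to the subnormalized state of the $n$ unsampled qubits when Sam accepts, so that its trace is the probability of acceptance. **Proposition.** (a) EPR-LOCC Sampling is invariant under the permutation of the sampler's register, in the following sense. Let $\beta>0$. There are constants $r(\epsilon)>0$ for $\epsilon>0$, depending only on $\beta$ and $\epsilon$, such that for all $n,k$ with $\beta N\le k$, where $N=n+k$, for every register $R$, every strategy of Paul and every density operator $\rho_{RS^N}$, there is a completely positive trace non-increasing map $\bar{\mathcal E}^{\mathrm{acc}}_{P^NS^N\to\Pi S^n}$, where $\mathcal H_P\simeq\mathcal H_S$ and $\Pi$ is a register with orthonormal basis $\{|\pi\rangle\}_{\pi\in S_n}$, such that 1. for some vector $|\bar\rho_{P^NS^N}\rangle\in\mathrm{Sym}^N(\mathcal H_P\otimes\mathcal H_S)$ that purifies $\frac1{N!}\sum_{\pi\in S_N}\pi\rho_{S^N}\pi^\dagger$, $$\frac1{n!}\sum_{\pi\in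 S_n}|\pi\rangle\langle\pi|_\Pi\otimes\pi\,\mathcal E^{\mathrm{acc}}(\rho_{RS^N})\,\pi^\dagger=\bar{\mathcal E}^{\mathrm{acc}}(\bar\rho_{P^NS^N});$$ 2. for every $\epsilon>0$ and every unit vector $|\theta\rangle\in\mathcal H_P\otimes\mathcal H_S$ whose reduced state satisfies $F(\theta_S,\varphi_S)^2<1-\epsilon$, $$\big\|\bar{\mathcal E}^{\mathrm{acc}}(|\theta\rangle\langle\theta|^{\otimes N})\big\|_1\le\exp(-r(\epsilon)N);$$ 3. for every unit vector $|\theta\rangle\in\mathcal H_P\otimes\mathcal H_S$, $\ \mathrm{tr}_\Pi\,\bar{\mathcal E}^{\mathrm{acc}}(|\theta\rangle\langle\theta|^{\otimes N})\le\theta_S^{\otimes n}$. (b) For every $\epsilon>0$ there is a constant $\gamma\in[0,1)$ such that for every unit vector $|\theta\rangle\in\mathcal H_P\otimes\mathcal H_S$ with $F(\theta_S,\varphi_S)^2<1-\epsilon$, where $P$ is a qubit: the probability of guessing, by any measurement on $P$ that may depend on the basis, the outcome of measuring $S$ in a uniformly random basis from $\{+,\times\}$ is at most $\gamma$; and for all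 $n,k$ and every strategy of Paul with $R=P^N$, Sam accepts on $|\theta\rangle^{\otimes N}$ with probability at most $\gamma^k$. -/

import Mathlib

open Matrix
open scoped Kronecker ComplexOrder

namespace QSampling

noncomputable section

/-! ### Finite-dimensional quantum registers

A register with an orthonormal basis indexed by the finite type `a` has state space `a → ℂ`;
operators on it are matrices `Matrix a a ℂ`.  The register `A^m` is indexed by `Fin m → a`. -/

/-- Operators on a register with basis indexed by `a`. -/
abbrev Op (a : Type) : Type := Matrix a a ℂ

/-- Unit vectors (pure states). -/
def IsUnitVector {a : Type} [Fintype a] (ψ : a → ℂ) : Prop := star ψ ⬝ᵥ ψ = 1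

/-- The operator `|ψ⟩⟨ψ|`. -/
def ketbra {a : Type} (ψ : a → ℂ) : Op a := vecMulVec ψ (star ψ)

/-- Density operators: positive semidefinite with trace one. -/
def IsDensity {a : Type} [Fintype a] (ρ : Op a) : Prop := ρ.PosSemidef ∧ ρ.trace = 1

/-- Partial trace over the first of two registers. -/
def traceFst {a b : Type} [Fintype a] (X : Op (a × b)) : Op b :=
  Matrix.of fun i j => ∑ x, X (x, i) (x, j)

section Norms

open scoped MatrixOrder

/-- The trace norm `‖A‖₁ = tr √(A† A)`. -/
def traceNorm {a : Type} [Fintype a] [DecidableEq a] (A : Op a) : ℝ :=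
  (CFC.sqrt (Aᴴ * A)).trace.re

/-- The fidelity `F(ρ, σ) = ‖√ρ √σ‖₁` (not squared). -/
def fidelity {a : Type} [Fintype a] [DecidableEq a] (ρ σ : Op a) : ℝ :=
  traceNorm (CFC.sqrt ρ * CFC.sqrt σ)

end Norms

/-- The superoperator `Φ ⊗ id_r`. -/
def tensorId {a b : Type} (r : Type) (Φ : Op a →ₗ[ℂ] Op b) (X : Op (a × r)) : Op (b × r) :=
  Matrix.of fun i j => Φ (Matrix.of fun x y => X (x, i.2) (y, j.2)) i.1 j.1

/-- Complete positivity: `Φ ⊗ id` preserves positivity for every finite-dimensional ancilla. -/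
def IsCompletelyPositive {a b : Type} (Φ : Op a →ₗ[ℂ] Op b) : Prop :=
  ∀ (m : ℕ) (X : Op (a × Fin m)), X.PosSemidef → (tensorId (Fin m) Φ X).PosSemidef

def IsTracePreserving {a b : Type} [Fintype a] [Fintype b] (Φ : Op a →ₗ[ℂ] Op b) : Prop :=
  ∀ X : Op a, (Φ X).trace = X.trace

def IsTraceNonincreasing {a b : Type} [Fintype a] [Fintype b] (Φ : Op a →ₗ[ℂ] Op b) : Prop :=
  ∀ X : Op a, X.PosSemidef → (Φ X).trace.re ≤ X.trace.re

/-- The unitary on `A^m` permuting the registers: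
`π (|φ₁⟩ ⊗ ⋯ ⊗ |φ_m⟩) = |φ_{π⁻¹(1)}⟩ ⊗ ⋯ ⊗ |φ_{π⁻¹(m)}⟩`. -/
def permOp (S : Type) [DecidableEq S] {m : ℕ} (π : Equiv.Perm (Fin m)) : Op (Fin m → S) :=
  Matrix.of fun a b => if a = b ∘ π.symm then 1 else 0

/-- The vector `|θ⟩^{⊗m}`, with the registers of `(P S)^m` regrouped as `P^m S^m`. -/
def iidVec {P S : Type} (m : ℕ) (θ : P × S → ℂ) : (Fin m → P) × (Fin m → S) → ℂ :=
  fun u => ∏ i, θ (u.1 i, u.2 i)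

/-- The operator `σ^{⊗m}`. -/
def tensorPow {S : Type} (m : ℕ) (σ : Op S) : Op (Fin m → S) :=
  Matrix.of fun a b => ∏ i, σ (a i) (b i)

/-- Membership in the symmetric subspace `Sym^m(H_P ⊗ H_S)`, with the registers regrouped as
`P^m S^m`: the pairs `P_i S_i` are permuted simultaneously. -/
def IsSymmetricVector {P S : Type} [Fintype P] [Fintype S] [DecidableEq P] [DecidableEq S] {m : ℕ}
    (ψ : (Fin m → P) × (Fin m → S) → ℂ) : Prop :=
  ∀ π : Equiv.Perm (Fin m), (permOp P π ⊗ₖ permOp S π) *ᵥ ψ = ψ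

/-! ### Sampling protocols

The total number of positions is `N = n + k`, of which `k` are sampled and `n` are output. -/

/-- The samples: subsets of the `N = n + k` positions having exactly `k` elements. -/
abbrev Sample (n k : ℕ) : Type := {t : Finset (Fin (n + k)) // t.card = k}

/-- The order-preserving identification of positions: the `k` slots on the left are the sampled
positions and the `n` slots on the right are the unsampled ones. -/
def samplePositions {n k : ℕ} (t : Sample n k) : Fin k ⊕ Fin n ≃ Fin (n + k) :=
  finSumEquivOfFinset (s := t.1) t.2 (by rw [Finset.card_compl, t.2, Fintype.card_fin]; omega)

/-- The basis label of `S^N` obtained from one of `S_t` and one of the unsampled registers. -/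
def mergeRegisters {S : Type} {n k : ℕ} (t : Sample n k) (a : Fin k → S) (b : Fin n → S) :
    Fin (n + k) → S :=
  fun i => Sum.elim a b ((samplePositions t).symm i)

/-- Sam's side of a sampling protocol with `N = n + k` positions and sample size `k`: the sample
`t` is uniform, the challenge `c` has the distribution `prob t`, Paul answers with a register `Q`,
and Sam accepts with the POVM element `accept t c` acting on `Q` and on the sampled registers. -/
structure SamplingProtocol (S C Q : Type) [Fintype S] [DecidableEq S] [Fintype C] [Fintype Q]
    [DecidableEq Q] (n k : ℕ) where
  prob : Sample n k → C → ℝ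
  prob_nonneg : ∀ t c, 0 ≤ prob t c
  prob_sum : ∀ t, ∑ c, prob t c = 1
  accept : Sample n k → C → Op (Q × (Fin k → S))
  accept_posSemidef : ∀ t c, (accept t c).PosSemidef
  accept_le_one : ∀ t c, (1 - accept t c).PosSemidef

/-- A (possibly dishonest) answering strategy for Paul, who holds the register `R`: after receiving
`t` and `c` he applies an arbitrary completely positive trace-preserving map producing `Q`
(whatever he keeps is traced out). -/
structure Strategy (R C Q : Type) [Fintype R] [Fintype Q] (n k : ℕ) where
  op : Sample n k → C → (Op R →ₗ[ℂ] Op Q)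
  completelyPositive : ∀ t c, IsCompletelyPositive (op t c)
  tracePreserving : ∀ t c, IsTracePreserving (op t c)

section Protocol

variable {S C Q : Type} [Fintype S] [DecidableEq S] [Fintype C] [Fintype Q] [DecidableEq Q]

/-- The map `E^acc` from `R S^N` to `S^n`: the subnormalized state of the unsampled registers when
Sam accepts; its trace is the probability that Sam accepts. -/
def accOutput {n k : ℕ} (prot : SamplingProtocol S C Q n k) {R : Type} [Fintype R]
    (A : Strategy R C Q n k) (ρ : Op (R × (Fin (n + k) → S))) : Op (Fin n → S) :=
  ∑ t : Sample n k, ∑ c : C,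
    (((((n + k).choose k : ℝ)⁻¹ * prot.prob t c : ℝ)) : ℂ) •
      traceFst ((prot.accept t c ⊗ₖ (1 : Op (Fin n → S))) *
        (tensorId (Fin (n + k) → S) (A.op t c) ρ).submatrix
          (fun u : (Q × (Fin k → S)) × (Fin n → S) => (u.1.1, mergeRegisters t u.1.2 u.2))
          (fun u : (Q × (Fin k → S)) × (Fin n → S) => (u.1.1, mergeRegisters t u.1.2 u.2)))

/-- `(1/m!) ∑_π π σ π†`. -/
def symmetrize {m : ℕ} (σ : Op (Fin m → S)) : Op (Fin m → S) :=
  ((m.factorial : ℂ)⁻¹) • ∑ π : Equiv.Perm (Fin m), permOp S π * σ * (permOp S π)ᴴ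

/-- `(1/m!) ∑_π |π⟩⟨π| ⊗ π σ π†`. -/
def symmetrizeWithRecord {m : ℕ} (σ : Op (Fin m → S)) :
    Op (Equiv.Perm (Fin m) × (Fin m → S)) :=
  ((m.factorial : ℂ)⁻¹) • ∑ π : Equiv.Perm (Fin m),
    ketbra (Pi.single π 1) ⊗ₖ (permOp S π * σ * (permOp S π)ᴴ)

end Protocol

/-- Invariance of a family of sampling protocols with reference state `φ` under permutations of the
sampler's register.  The sample size is of the order of the number of positions: `β N ≤ k ≤ N` with
`N = n + k`.  The implicit constant `rate ε` of the bound `exp(-Ω(N))` depends on `β` and `ε` only.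
The register `P` is a copy of `S`. -/
def IsPermutationInvariant {S : Type} [Fintype S] [DecidableEq S] {C Q : ℕ → ℕ → Type}
    [∀ n k, Fintype (C n k)] [∀ n k, Fintype (Q n k)] [∀ n k, DecidableEq (Q n k)]
    (prot : ∀ n k, SamplingProtocol S (C n k) (Q n k) n k) (φ : Op S) : Prop :=
  ∀ β : ℝ, 0 < β → ∃ rate : ℝ → ℝ, (∀ ε, 0 < ε → 0 < rate ε) ∧
    ∀ n k : ℕ, β * ((n + k : ℕ) : ℝ) ≤ k →
    ∀ (R : Type) [Fintype R] (A : Strategy R (C n k) (Q n k) n k)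
      (ρ : Op (R × (Fin (n + k) → S))), IsDensity ρ →
    ∃ Ebar : Op ((Fin (n + k) → S) × (Fin (n + k) → S)) →ₗ[ℂ]
        Op (Equiv.Perm (Fin n) × (Fin n → S)),
      IsCompletelyPositive Ebar ∧ IsTraceNonincreasing Ebar ∧
      -- the attack is equivalent to an attack on a symmetric purification
      (∃ ψ : (Fin (n + k) → S) × (Fin (n + k) → S) → ℂ,
        IsSymmetricVector ψ ∧
        traceFst (ketbra ψ) = symmetrize (traceFst ρ) ∧
        symmetrizeWithRecord (accOutput (prot n k) A ρ) = Ebar (ketbra ψ)) ∧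
      -- i.i.d. states far from the reference state are rejected
      (∀ ε : ℝ, 0 < ε → ∀ θ : S × S → ℂ, IsUnitVector θ →
        fidelity (traceFst (ketbra θ)) φ ^ 2 < 1 - ε →
        traceNorm (Ebar (ketbra (iidVec (n + k) θ)))
          ≤ Real.exp (-(rate ε * ((n + k : ℕ) : ℝ)))) ∧
      -- the unsampled registers are not touched
      (∀ θ : S × S → ℂ, IsUnitVector θ →
        (tensorPow n (traceFst (ketbra θ)) -
          traceFst (Ebar (ketbra (iidVec (n + k) θ)))).PosSemidef)

/-! ### EPR-LOCC sampling -/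

/-- The two BB84 bases: computational `+` and diagonal `×`. -/
inductive BB84
  | plus
  | times
  deriving DecidableEq

instance : Fintype BB84 where
  elems := {.plus, .times}
  complete c := by cases c <;> simp

/-- The Hadamard unitary. -/
def hadamard : Op (Fin 2) := (((Real.sqrt 2)⁻¹ : ℝ) : ℂ) • !![1, 1; 1, -1]

/-- The vector `H^c |x⟩`. -/
def bb84Vec : BB84 → Fin 2 → (Fin 2 → ℂ)
  | .plus, x => Pi.single x 1
  | .times, x => hadamard *ᵥ Pi.single x 1

/-- The projector `H^{⊗c} |x⟩⟨x| H^{⊗c}` onto the string `x` in the bases `c`. -/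
def bb84Proj {k : ℕ} (c : Fin k → BB84) (x : Fin k → Fin 2) : Op (Fin k → Fin 2) :=
  ketbra fun s => ∏ i, bb84Vec (c i) (x i) (s i)

/-- Sam reads Paul's classical message `x`, measures his sampled qubits in the bases `c`, and
accepts if and only if the outcome equals `x`: the POVM element `∑_x |x⟩⟨x| ⊗ P^{x,c}`. -/
def eprAccept {k : ℕ} (c : Fin k → BB84) : Op ((Fin k → Fin 2) × (Fin k → Fin 2)) :=
  ∑ x : Fin k → Fin 2, ketbra (Pi.single x 1) ⊗ₖ bb84Proj c x

theorem bb84Vec_unit (c : BB84) (x : Fin 2) : IsUnitVector (bb84Vec c x) := by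
  have h : ((Real.sqrt 2 : ℝ) : ℂ) * ((Real.sqrt 2 : ℝ) : ℂ) = 2 := by
    rw [← Complex.ofReal_mul, Real.mul_self_sqrt (by norm_num)]; norm_num
  have h' : (((Real.sqrt 2 : ℝ) : ℂ))⁻¹ * (((Real.sqrt 2 : ℝ) : ℂ))⁻¹ = 1 / 2 := by
    rw [← mul_inv, h]; norm_num
  cases c <;> fin_cases x <;>
    simp [IsUnitVector, bb84Vec, hadamard, dotProduct, Fin.sum_univ_two, Matrix.mulVec, h'] <;>
    norm_num

theorem ketbra_posSemidef {a : Type} [Fintype a] (ψ : a → ℂ) : (ketbra ψ).PosSemidef :=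
  Matrix.posSemidef_vecMulVec_self_star ψ

theorem ketbra_mul_self {a : Type} [Fintype a] {ψ : a → ℂ} (h : IsUnitVector ψ) :
    ketbra ψ * ketbra ψ = ketbra ψ := by
  unfold ketbra
  rw [Matrix.vecMulVec_mul_vecMulVec, h, one_smul]

theorem prod_unit {k : ℕ} {a : Type} [Fintype a] (v : Fin k → a → ℂ)
    (h : ∀ i, IsUnitVector (v i)) : IsUnitVector fun s : Fin k → a => ∏ i, v i (s i) := by
  classical
  unfold IsUnitVector dotProduct at *
  simp only [Pi.star_apply, star_prod, ← Finset.prod_mul_distrib] at *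
  rw [← Fintype.prod_sum (fun i j => star (v i j) * v i j)]
  exact Finset.prod_eq_one fun i _ => h i

theorem bb84Proj_mul_self {k : ℕ} (c : Fin k → BB84) (x : Fin k → Fin 2) :
    bb84Proj c x * bb84Proj c x = bb84Proj c x :=
  ketbra_mul_self (prod_unit _ fun _ => bb84Vec_unit _ _)

theorem eprAccept_posSemidef {k : ℕ} (c : Fin k → BB84) : (eprAccept c).PosSemidef :=
  Matrix.posSemidef_sum _ fun _ _ => (ketbra_posSemidef _).kronecker (ketbra_posSemidef _)

theorem eprAccept_mul_self {k : ℕ} (c : Fin k → BB84) :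
    eprAccept c * eprAccept c = eprAccept c := by
  unfold eprAccept
  rw [Finset.sum_mul]
  refine Finset.sum_congr rfl fun x _ => ?_
  rw [Finset.mul_sum, Finset.sum_eq_single x]
  · rw [← Matrix.mul_kronecker_mul, bb84Proj_mul_self, ketbra_mul_self (by simp [IsUnitVector])]
  · intro y _ hy
    rw [← Matrix.mul_kronecker_mul]
    have : ketbra (Pi.single x (1 : ℂ)) * ketbra (Pi.single y 1) = 0 := by
      unfold ketbra
      rw [Matrix.vecMulVec_mul_vecMulVec]
      simp [hy.symm]
    rw [this, Matrix.zero_kronecker]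
  · simp

theorem eprAccept_le_one {k : ℕ} (c : Fin k → BB84) : (1 - eprAccept c).PosSemidef := by
  have h : 1 - eprAccept c = (1 - eprAccept c)ᴴ * (1 - eprAccept c) := by
    rw [Matrix.conjTranspose_sub, Matrix.conjTranspose_one, (eprAccept_posSemidef c).1]
    rw [mul_sub, sub_mul, sub_mul, eprAccept_mul_self]
    simp
  rw [h]
  exact Matrix.posSemidef_conjTranspose_mul_self _

/-- The EPR-LOCC sampling protocol: the bases `c` are uniform and independent of `t`. -/
def eprLOCC (n k : ℕ) : SamplingProtocol (Fin 2) (Fin k → BB84) (Fin k → Fin 2) n k where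
  prob _ _ := ((2 : ℝ) ^ k)⁻¹
  prob_nonneg _ _ := by positivity
  prob_sum _ := by
    have : Fintype.card BB84 = 2 := rfl
    simp [this]
  accept _ c := eprAccept c
  accept_posSemidef _ c := eprAccept_posSemidef c
  accept_le_one _ c := eprAccept_le_one c

/-- The reference state `id/2`, the reduced state of an EPR pair. -/
def eprReference : Op (Fin 2) := (1 / 2 : ℂ) • 1

/-- The probability of guessing, by means of the POVM `E c` on `P`, the outcome of measuring the
register `S` of `|θ⟩_{PS}` in a uniformly random but known basis `c`. -/
def guessProb (E : BB84 → Fin 2 → Op (Fin 2)) (θ : Fin 2 × Fin 2 → ℂ) : ℝ :=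
  (1 / 2) * ∑ c : BB84, ∑ x : Fin 2, ((E c x ⊗ₖ ketbra (bb84Vec c x)) * ketbra θ).trace.re

/-- A POVM with outcomes indexed by `x`. -/
def IsPOVM {a x : Type} [DecidableEq a] [Fintype x] (E : x → Op a) : Prop :=
  (∀ i, (E i).PosSemidef) ∧ ∑ i, E i = 1

end

end QSampling

namespace QSampling

noncomputable section

/-! ### Positive semidefinite operators -/

/-! Part (b) is Helstrom's bound, an uncertainty relation and multiplicativity of semidefinite
duality. When `S` is measured in basis `c`, `P` is left in one of two subnormalized vectors.
`exists_dominating_op` gives an operator `K c` above both of their projectors, whose trace is the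
optimal guessing probability `(1 + √(1 - 4|v|²)) / 2`, where `v` is their inner product. The values
of `|v|²` for the two bases add up to at least `1/4 - det θ_S` (`quarter_sub_det_le_overlaps`), and
for a qubit `F(θ_S, id/2)² = 1/2 + √(det θ_S)`. Low fidelity therefore makes one overlap large, and
the average trace of `K c` is at most `guessBound ε < 1`. Domination passes to tensor products, so
the operators `K (c i)` on the sampled positions bound every joint measurement on `P^N`, and
averaging over `c` gives the `k`-th power.

For part (a), let `σ` be the symmetrized state of `S^N` and `T = √σ`. Since `σ` commutes with
permutations, so does `T`, and its vectorization is a symmetric purification. Fix one sample `t₀`.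
Each permutation of the `N` positions corresponds to exactly one triple: a sample `t` carried to
`t₀`, a permutation `κ` of the sampled positions and a permutation `π` of the others
(`samplePerm_bijective`). The average over `S_N` thus already contains the random sample. For every
`c`, the states of `S^N` conditioned on Paul's answer and on the permutation form a decomposition of
`σ`. Any such decomposition is induced by a measurement of the purifying register
(`mul_pseudoInverse_mul`), so there is a POVM on `P^N` that produces the answer `x` and the record
`π`. The map in `exists_attackMap` performs it, lets Sam measure at `t₀`, and accepts if the
outcomes agree.

That map does not act on the unsampled registers, which yields condition 3. On i.i.d. states it is
an attack as in (b), with acceptance probability at most `guessBound ε ^ k`; since `k ≥ βN`,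
condition 2 follows. -/

theorem posSemidef_exists_factor {a : Type} [Fintype a] {A : Op a} (hA : A.PosSemidef) :
    ∃ B : Op a, A = Bᴴ * B := by
  classical
  open scoped MatrixOrder in
  exact CStarAlgebra.nonneg_iff_eq_star_mul_self.mp hA.nonneg

theorem posSemidef_trace_re_nonneg {a : Type} [Fintype a] {A : Op a} (hA : A.PosSemidef) :
    0 ≤ A.trace.re := (Complex.nonneg_iff.mp hA.trace_nonneg).1

theorem posSemidef_trace_mul_re_nonneg {a : Type} [Fintype a] {A B : Op a}
    (hA : A.PosSemidef) (hB : B.PosSemidef) : 0 ≤ (A * B).trace.re := by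
  obtain ⟨V, rfl⟩ := posSemidef_exists_factor hA
  rw [Matrix.mul_assoc, Matrix.trace_mul_comm]
  exact posSemidef_trace_re_nonneg (hB.mul_mul_conjTranspose_same V)

theorem traceNorm_of_posSemidef {a : Type} [Fintype a] [DecidableEq a] {A : Op a}
    (hA : A.PosSemidef) : traceNorm A = A.trace.re := by
  open scoped MatrixOrder in
  rw [traceNorm, hA.1.eq, CFC.sqrt_mul_self A hA.nonneg]

theorem one_sub_posSemidef_of_isProj {a : Type} [Fintype a] [DecidableEq a] {A : Op a}
    (hA : A.IsHermitian) (h : A * A = A) : (1 - A).PosSemidef := by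
  have : 1 - A = (1 - A)ᴴ * (1 - A) := by
    rw [Matrix.conjTranspose_sub, Matrix.conjTranspose_one, hA.eq, mul_sub, sub_mul, sub_mul, h]
    simp
  rw [this]
  exact Matrix.posSemidef_conjTranspose_mul_self _

/-- A positive semidefinite operator dominated by `σ` is supported on the support of `σ`. -/
theorem mul_eq_zero_of_dominated {a : Type} [Fintype a] {τ σ Z : Op a}
    (hτ : τ.PosSemidef) (h : (σ - τ).PosSemidef) (hZ : σ * Z = 0) : τ * Z = 0 := by
  obtain ⟨V, rfl⟩ := posSemidef_exists_factor hτ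
  have h1 := h.conjTranspose_mul_mul_same Z
  -- Compressed to the kernel of `σ`, the difference is both positive and negative semidefinite, so
  -- `V * Z = 0`.
  have h2 : Zᴴ * (σ - Vᴴ * V) * Z = -((V * Z)ᴴ * (V * Z)) := by
    rw [Matrix.mul_sub, Matrix.sub_mul, Matrix.mul_assoc, hZ, Matrix.conjTranspose_mul]
    simp [Matrix.mul_assoc]
  rw [h2] at h1
  have h3 : (V * Z)ᴴ * (V * Z) = 0 := by
    open scoped MatrixOrder in
    exact le_antisymm (by simpa using h1.nonneg)
      (Matrix.posSemidef_conjTranspose_mul_self (V * Z)).nonneg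
  rw [Matrix.mul_assoc, Matrix.conjTranspose_mul_self_eq_zero.mp h3, Matrix.mul_zero]

/-- A positive semidefinite operator has a square root, with a Hermitian pseudo-inverse, commuting
with everything that commutes with the operator. -/
theorem exists_sqrt_pseudoInverse {a : Type} [Fintype a] [DecidableEq a] {σ : Op a}
    (hσ : σ.PosSemidef) :
    ∃ T G : Op a, T.IsHermitian ∧ G.IsHermitian ∧ T * T = σ ∧ T * G = G * T ∧
      (T * G) * (T * G) = T * G ∧ (T * G).IsHermitian ∧ σ * (T * G) = σ ∧ G * σ * G = T * G ∧
      ∀ U : Op a, Commute σ U → Commute T U := by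
  have hsa : IsSelfAdjoint σ := hσ.1
  -- The spectrum is finite, so even the discontinuous function `(√x)⁻¹` is admissible in the
  -- functional calculus.
  have hc : ∀ f : ℝ → ℝ, ContinuousOn f (spectrum ℝ σ) := fun f =>
    (Matrix.finite_real_spectrum (A := σ)).continuousOn f
  have hnn : ∀ x ∈ spectrum ℝ σ, 0 ≤ x := by
    intro x hx
    rw [hσ.1.spectrum_real_eq_range_eigenvalues] at hx
    obtain ⟨i, rfl⟩ := hx
    exact hσ.eigenvalues_nonneg i
  have hmul : ∀ f g : ℝ → ℝ, cfc f σ * cfc g σ = cfc (fun x => f x * g x) σ := fun f g =>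
    (cfc_mul f g σ (hc f) (hc g)).symm
  have hid : cfc (fun x : ℝ => x) σ = σ := cfc_id' ℝ σ hsa
  have hσl : ∀ f : ℝ → ℝ, σ * cfc f σ = cfc (fun x => x * f x) σ := fun f => by
    conv_lhs => enter [1]; rw [← hid]
    exact hmul _ _
  -- Because `0⁻¹ = 0`, the second operator vanishes on the kernel of `σ`, and `T * G` is the
  -- projector onto the support.
  refine ⟨cfc (fun x => √x) σ, cfc (fun x => (√x)⁻¹) σ, cfc_predicate _ σ, cfc_predicate _ σ,
    ?_, ?_, ?_, ?_, ?_, ?_, ?_⟩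
  · rw [hmul]
    conv_rhs => rw [← hid]
    exact cfc_congr fun x hx => Real.mul_self_sqrt (hnn x hx)
  · rw [hmul, hmul]
    exact cfc_congr fun x _ => mul_comm _ _
  · rw [hmul, hmul]
    refine cfc_congr fun x _ => ?_
    by_cases h : √x = 0
    · simp [h]
    · simp [h]
  · rw [hmul]
    exact cfc_predicate _ σ
  · rw [hmul, hσl]
    conv_rhs => rw [← hid]
    refine cfc_congr fun x hx => ?_
    by_cases h : √x = 0
    · simp [(Real.sqrt_eq_zero (hnn x hx)).mp h]
    · simp [h]
  · rw [Matrix.mul_assoc, hσl, hmul, hmul]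
    refine cfc_congr fun x hx => ?_
    by_cases h : √x = 0
    · simp [h]
    · have : x = √x * √x := (Real.mul_self_sqrt (hnn x hx)).symm
      field_simp
      nlinarith
  · exact fun U hU => hU.cfc_real _

/-! ### Tensor products over a finite index type -/

/-- The operator `⊗ᵢ f i`. -/
def piTensor {ι P : Type} [Fintype ι] (f : ι → Op P) : Op (ι → P) :=
  Matrix.of fun p q => ∏ i, f i (p i) (q i)

section PiTensor

variable {ι P : Type} [Fintype ι] [DecidableEq ι] [Fintype P]

theorem piTensor_mul (f g : ι → Op P) : piTensor f * piTensor g = piTensor fun i => f i * g i := by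
  ext p q
  simp only [piTensor, Matrix.mul_apply, Matrix.of_apply, ← Finset.prod_mul_distrib]
  rw [Fintype.prod_sum]

theorem piTensor_posSemidef {f : ι → Op P} (hf : ∀ i, (f i).PosSemidef) :
    (piTensor f).PosSemidef := by
  choose V hV using fun i => posSemidef_exists_factor (hf i)
  have : piTensor f = (piTensor V)ᴴ * piTensor V := by
    have h : (piTensor V)ᴴ = piTensor fun i => (V i)ᴴ := by
      ext p q
      simp [piTensor, Matrix.conjTranspose_apply]
    rw [h, piTensor_mul]
    exact congrArg piTensor (funext hV)
  rw [this]
  exact Matrix.posSemidef_conjTranspose_mul_self _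

/-- Expand each factor as `g i = f i + (g i - f i)`: the product becomes a sum over subsets of
tensor products of positive operators, and the full subset contributes `piTensor f`. -/
theorem piTensor_sub_posSemidef {f g : ι → Op P} (hf : ∀ i, (f i).PosSemidef)
    (hfg : ∀ i, (g i - f i).PosSemidef) : (piTensor g - piTensor f).PosSemidef := by
  have h : piTensor g = ∑ s : Finset ι, piTensor fun i => if i ∈ s then f i else g i - f i := by
    ext p q
    rw [Matrix.sum_apply]
    simp only [piTensor, Matrix.of_apply]
    have : ∀ i, g i (p i) (q i) = f i (p i) (q i) + (g i - f i) (p i) (q i) := fun i => by simp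
    simp_rw [this]
    rw [Fintype.prod_add]
    refine Finset.sum_congr rfl fun s _ => ?_
    rw [← Finset.prod_mul_prod_compl s]
    congr 1
    · exact Finset.prod_congr rfl fun i hi => by simp [hi]
    · exact Finset.prod_congr rfl fun i hi => by simp [Finset.mem_compl.mp hi]
  have h' : piTensor f =
      piTensor fun i => if i ∈ (Finset.univ : Finset ι) then f i else g i - f i := by simp
  rw [h, h', ← Finset.sum_erase_eq_sub (Finset.mem_univ (Finset.univ : Finset ι))]
  refine Matrix.posSemidef_sum _ fun s _ => piTensor_posSemidef fun i => ?_
  split_ifs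
  exacts [hf i, hfg i]

theorem trace_piTensor (f : ι → Op P) : (piTensor f).trace = ∏ i, (f i).trace := by
  simp only [Matrix.trace, Matrix.diag, piTensor, Matrix.of_apply]
  rw [Fintype.prod_sum]

end PiTensor

/-- Guessing from an ensemble `ρ` is bounded by the trace of any operator dominating it. -/
theorem sum_functional_le_trace {a x : Type} [Fintype a] [Fintype x] {L : x → Op a →ₗ[ℂ] ℂ}
    (hpos : ∀ i (Y : Op a), Y.PosSemidef → 0 ≤ (L i Y).re)
    (hsum : ∀ Y : Op a, Y.PosSemidef → ∑ i, (L i Y).re ≤ Y.trace.re)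
    {ρ : x → Op a} {K : Op a} (hK : K.PosSemidef) (hρ : ∀ i, (K - ρ i).PosSemidef) :
    ∑ i, (L i (ρ i)).re ≤ K.trace.re := by
  refine (Finset.sum_le_sum fun i _ => ?_).trans (hsum K hK)
  have := hpos i _ (hρ i)
  rw [map_sub, Complex.sub_re] at this
  linarith

/-! ### Discrimination of two vectors of a qubit -/

/-- Here `A = w⁻¹ • (Aᴴ * A)`. -/
theorem posSemidef_of_mul_self_eq_smul {a : Type} [Fintype a] {A : Op a} (hA : A.IsHermitian)
    {w : ℝ} (hw : 0 < w) (h : A * A = (w : ℂ) • A) : A.PosSemidef := by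
  have hwne : (w : ℂ) ≠ 0 := by exact_mod_cast hw.ne'
  have h1 : A = ((w⁻¹ : ℝ) : ℂ) • (Aᴴ * A) := by
    rw [hA.eq, h, smul_smul, Complex.ofReal_inv, inv_mul_cancel₀ hwne, one_smul]
  rw [h1]
  exact (Matrix.posSemidef_conjTranspose_mul_self A).smul
    (by rw [Complex.zero_le_real]; positivity)

/-- The roots of a quadratic equation satisfied by a Hermitian operator bound its spectrum. -/
theorem posSemidef_spectral_bounds {a : Type} [Fintype a] [DecidableEq a] {D : Op a}
    (hD : D.IsHermitian) {d m w : ℝ} (hDD : D * D = (d : ℂ) • D + (m : ℂ) • 1) (hw : 0 < w)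
    (hww : w * w = d ^ 2 + 4 * m) :
    ((((d + w) / 2 : ℝ) : ℂ) • (1 : Op a) - D).PosSemidef ∧
      (D - (((d - w) / 2 : ℝ) : ℂ) • (1 : Op a)).PosSemidef := by
  have hwC : (w : ℂ) * w = d ^ 2 + 4 * m := by exact_mod_cast hww
  have h1 : ∀ r : ℝ, ((r : ℂ) • (1 : Op a)).IsHermitian := fun r => by
    simp [Matrix.IsHermitian, Matrix.conjTranspose_smul]
  -- The roots of the quadratic equation differ by `w`, so both operators have spectrum in `{0, w}`
  -- and satisfy `A * A = w • A`.
  refine ⟨posSemidef_of_mul_self_eq_smul ((h1 _).sub hD) hw ?_,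
    posSemidef_of_mul_self_eq_smul (hD.sub (h1 _)) hw ?_⟩ <;>
  · rw [mul_sub, sub_mul, sub_mul, hDD]
    simp only [Matrix.smul_mul, Matrix.mul_smul, Matrix.one_mul, Matrix.mul_one, smul_smul,
      smul_sub]
    ext i j
    simp only [Matrix.sub_apply, Matrix.smul_apply, Matrix.add_apply, smul_eq_mul]
    push_cast
    linear_combination (-(1 : Op a) i j / 4) * hwC

/-- A dual witness for the discrimination of two pure subnormalized qubit states. -/
theorem exists_dominating_op {v₀ v₁ : Fin 2 → ℂ} (h : star v₀ ⬝ᵥ v₀ + star v₁ ⬝ᵥ v₁ = 1) :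
    ∃ K : Op (Fin 2), K.PosSemidef ∧ (K - ketbra v₀).PosSemidef ∧ (K - ketbra v₁).PosSemidef ∧
      K.trace.re = (1 + √(1 - 4 * Complex.normSq (star v₀ ⬝ᵥ v₁))) / 2 := by
  set D : Op (Fin 2) := ketbra v₀ - ketbra v₁ with hD
  set d : ℝ := Complex.normSq (v₀ 0) + Complex.normSq (v₀ 1) - Complex.normSq (v₁ 0)
    - Complex.normSq (v₁ 1) with hd
  set m : ℝ := Complex.normSq (v₀ 0 * v₁ 1 - v₀ 1 * v₁ 0) with hm
  have hm0 : 0 ≤ m := Complex.normSq_nonneg _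
  have hDh : D.IsHermitian := (ketbra_posSemidef v₀).1.sub (ketbra_posSemidef v₁).1
  -- Cayley–Hamilton: `D` has trace `d` and determinant `-m`.
  have hDD : D * D = (d : ℂ) • D + (m : ℂ) • 1 := by
    ext i j
    simp only [hD, hd, hm, ketbra, Matrix.mul_apply, Matrix.sub_apply, Matrix.add_apply,
      Matrix.smul_apply, Matrix.vecMulVec_apply, Fin.sum_univ_two, Pi.star_apply, smul_eq_mul,
      Complex.ofReal_sub, Complex.ofReal_add, Complex.normSq_eq_conj_mul_self, map_sub, map_mul]
    fin_cases i <;> fin_cases j <;> simp <;> ring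
  have hnorm : Complex.normSq (v₀ 0) + Complex.normSq (v₀ 1) + Complex.normSq (v₁ 0)
      + Complex.normSq (v₁ 1) = 1 := by
    have : ((Complex.normSq (v₀ 0) + Complex.normSq (v₀ 1) + Complex.normSq (v₁ 0)
      + Complex.normSq (v₁ 1) : ℝ) : ℂ) = 1 := by
      rw [← h]
      simp [dotProduct, Fin.sum_univ_two, Complex.normSq_eq_conj_mul_self]
      ring
    exact_mod_cast this
  -- Lagrange's identity: `m` is the product of the squared norms minus the squared modulus of the
  -- inner product. The `1` is homogenized as the square of the sum of the squared norms.
  have hw : 1 - 4 * Complex.normSq (star v₀ ⬝ᵥ v₁) = d ^ 2 + 4 * m := by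
    have h1 : (1 : ℝ) = (Complex.normSq (v₀ 0) + Complex.normSq (v₀ 1) + Complex.normSq (v₁ 0)
      + Complex.normSq (v₁ 1)) ^ 2 := by rw [hnorm]; norm_num
    rw [h1, hd, hm]
    apply Complex.ofReal_injective
    simp only [dotProduct, Fin.sum_univ_two, Pi.star_apply, RCLike.star_def,
      Complex.ofReal_sub, Complex.ofReal_add, Complex.ofReal_mul, Complex.ofReal_pow,
      Complex.normSq_eq_conj_mul_self, map_sub, map_mul, map_add, Complex.conj_conj]
    push_cast
    ring
  rw [hw]
  set w : ℝ := √(d ^ 2 + 4 * m) with hwdef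
  have hw0 : 0 ≤ w := Real.sqrt_nonneg _
  have hww : w * w = d ^ 2 + 4 * m := Real.mul_self_sqrt (by positivity)
  have htr₀ : (ketbra v₀).trace.re = (1 + d) / 2 := by
    have : (ketbra v₀).trace = ((Complex.normSq (v₀ 0) + Complex.normSq (v₀ 1) : ℝ) : ℂ) := by
      simp [ketbra, Matrix.trace, Fin.sum_univ_two, Matrix.vecMulVec_apply, Complex.mul_conj]
    rw [this, Complex.ofReal_re]
    linarith
  rcases hw0.eq_or_lt with hz | hpos
  -- In this case the two projectors coincide, and either of them is the witness.
  · have hd0 : d = 0 := by nlinarith [sq_nonneg d]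
    have hm00 : m = 0 := by nlinarith [sq_nonneg d]
    have hD0 : D = 0 := by
      have : Dᴴ * D = 0 := by rw [hDh.eq, hDD, hd0, hm00]; simp
      exact Matrix.conjTranspose_mul_self_eq_zero.mp this
    refine ⟨ketbra v₀, ketbra_posSemidef _, by simpa using Matrix.PosSemidef.zero, ?_, ?_⟩
    · rw [← hD, hD0]; exact Matrix.PosSemidef.zero
    · rw [htr₀, hd0, ← hz]
  · have hle : |d| ≤ w := Real.abs_le_sqrt (by linarith)
    have hle1 := (abs_le.mp hle).1
    have hle2 := (abs_le.mp hle).2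
    have hwne : (w : ℂ) ≠ 0 := by exact_mod_cast hpos.ne'
    obtain ⟨hA, hB⟩ := posSemidef_spectral_bounds hDh hDD hpos hww
    have hA' : ((((w - d) / (2 * w) : ℝ) : ℂ) •
        ((((d + w) / 2 : ℝ) : ℂ) • (1 : Op (Fin 2)) - D)).PosSemidef :=
      hA.smul (by rw [Complex.zero_le_real]; exact div_nonneg (by linarith) (by linarith))
    have hB' : ((((w + d) / (2 * w) : ℝ) : ℂ) •
        (D - (((d - w) / 2 : ℝ) : ℂ) • (1 : Op (Fin 2)))).PosSemidef :=
      hB.smul (by rw [Complex.zero_le_real]; exact div_nonneg (by linarith) (by linarith))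
    -- The added term is the negative part of `D`, whose eigenvalues are `(d ± w) / 2`. Subtracting
    -- `ketbra v₁` from the sum leaves the positive part of `D`.
    refine ⟨ketbra v₀ + (((w - d) / (2 * w) : ℝ) : ℂ) •
      ((((d + w) / 2 : ℝ) : ℂ) • (1 : Op (Fin 2)) - D), (ketbra_posSemidef _).add hA', ?_, ?_, ?_⟩
    · rwa [add_sub_cancel_left]
    · convert hB' using 1
      rw [add_sub_right_comm, ← hD]
      ext i j
      simp only [Matrix.sub_apply, Matrix.smul_apply, Matrix.add_apply, smul_eq_mul]
      push_cast
      field_simp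
      ring
    · have htD : D.trace.re = d := by
        rw [hD, Matrix.trace_sub, Complex.sub_re, htr₀]
        have : (ketbra v₁).trace = ((Complex.normSq (v₁ 0) + Complex.normSq (v₁ 1) : ℝ) : ℂ) := by
          simp [ketbra, Matrix.trace, Fin.sum_univ_two, Matrix.vecMulVec_apply, Complex.mul_conj]
        rw [this, Complex.ofReal_re]
        linarith
      rw [Matrix.trace_add, Matrix.trace_smul, Matrix.trace_sub, Matrix.trace_smul, Complex.add_re,
        htr₀, smul_eq_mul, Complex.re_ofReal_mul, Complex.sub_re, htD, smul_eq_mul,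
        Complex.re_ofReal_mul]
      simp only [Matrix.trace_one, Fintype.card_fin]
      norm_num
      field_simp
      ring

/-! ### Fidelity with the maximally mixed qubit -/

theorem traceFst_posSemidef {a b : Type} [Fintype a] [Fintype b] {X : Op (a × b)}
    (hX : X.PosSemidef) : (traceFst X).PosSemidef := by
  have : traceFst X = ∑ x, X.submatrix (fun i => (x, i)) (fun i => (x, i)) := by
    ext i j
    simp [traceFst, Matrix.sum_apply]
  rw [this]
  exact Matrix.posSemidef_sum _ fun x _ => hX.submatrix _

theorem trace_traceFst {a b : Type} [Fintype a] [Fintype b] (X : Op (a × b)) :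
    (traceFst X).trace = X.trace := by
  simp only [Matrix.trace, Matrix.diag, traceFst, Matrix.of_apply, Fintype.sum_prod_type]
  exact Finset.sum_comm

theorem trace_ketbra {a : Type} [Fintype a] (ψ : a → ℂ) : (ketbra ψ).trace = star ψ ⬝ᵥ ψ := by
  rw [ketbra, Matrix.trace_vecMulVec, dotProduct_comm]

theorem eprReference_posSemidef : eprReference.PosSemidef :=
  Matrix.PosSemidef.one.smul (by norm_num [Complex.le_def])

/-- For the positive 2×2 matrix `T` whose trace is the fidelity, `(tr T)² = tr T² + 2 det T`, with
`tr T² = 1/2` and `(det T)² = det σ / 4`. Hence `F² = 1/2 + √(det σ)`, and both conclusions follow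
from `det T ≥ 0`. -/
theorem det_lt_of_fidelity_lt {σ : Op (Fin 2)} (hσ : IsDensity σ) {ε : ℝ}
    (h : fidelity σ eprReference ^ 2 < 1 - ε) : ε < 1 / 2 ∧ σ.det.re < (1 / 2 - ε) ^ 2 := by
  open scoped MatrixOrder in
  obtain ⟨hσ, htr⟩ := hσ
  unfold fidelity traceNorm at h
  set X := CFC.sqrt σ * CFC.sqrt eprReference
  have hXX : 0 ≤ Xᴴ * X := (Matrix.posSemidef_conjTranspose_mul_self X).nonneg
  set T := CFC.sqrt (Xᴴ * X)
  have hTT : T * T = Xᴴ * X := CFC.sqrt_mul_sqrt_self _ hXX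
  have hT : T.PosSemidef := (CFC.sqrt_nonneg _).posSemidef
  have hsσ : CFC.sqrt σ * CFC.sqrt σ = σ := CFC.sqrt_mul_sqrt_self _ hσ.nonneg
  have hsr : CFC.sqrt eprReference * CFC.sqrt eprReference = eprReference :=
    CFC.sqrt_mul_sqrt_self _ eprReference_posSemidef.nonneg
  have hXX' : Xᴴ * X = CFC.sqrt eprReference * σ * CFC.sqrt eprReference := by
    have h1 : (CFC.sqrt σ)ᴴ = CFC.sqrt σ := (CFC.sqrt_nonneg σ).posSemidef.1
    have h2 : (CFC.sqrt eprReference)ᴴ = CFC.sqrt eprReference :=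
      (CFC.sqrt_nonneg eprReference).posSemidef.1
    simp only [X, Matrix.conjTranspose_mul, h1, h2]
    conv_rhs => rw [← hsσ]
    simp only [Matrix.mul_assoc]
  have htrT : (T * T).trace = 1 / 2 := by
    rw [hTT, hXX', Matrix.trace_mul_comm, ← Matrix.mul_assoc, hsr, eprReference]
    simp [htr]
  have hdetT : T.det * T.det = σ.det / 4 := by
    rw [← Matrix.det_mul, hTT, hXX', Matrix.det_mul, Matrix.det_mul, mul_right_comm,
      ← Matrix.det_mul, hsr, eprReference]
    simp
    ring
  have hid : T.trace * T.trace = (T * T).trace + 2 * T.det := by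
    simp [Matrix.trace, Matrix.det_fin_two, Fin.sum_univ_two, Matrix.mul_apply]
    ring
  have hd0 := hT.det_nonneg
  have ht0 := hT.trace_nonneg
  rw [Complex.nonneg_iff] at hd0 ht0
  have e1 := congrArg Complex.re hid
  have e2 := congrArg Complex.re hdetT
  rw [htrT] at e1
  simp [← ht0.2, ← hd0.2] at e1 e2
  have e3 : σ.det.re = 4 * T.det.re ^ 2 := by
    linarith
  have e4 : T.det.re < (1 / 2 - ε) / 2 := by nlinarith
  exact ⟨by linarith, by rw [e3]; nlinarith⟩

/-! ### Guessing the outcome of a BB84 measurement -/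

/-- The subnormalized state of `P` when `S` is measured in the basis `c` with outcome `x`. -/
def conditionalVec (θ : Fin 2 × Fin 2 → ℂ) (c : BB84) (x : Fin 2) : Fin 2 → ℂ :=
  fun p => ∑ s, star (bb84Vec c x s) * θ (p, s)

/-- The inner product of the two conditional states in the basis `c`. -/
def overlap (θ : Fin 2 × Fin 2 → ℂ) (c : BB84) : ℂ :=
  star (conditionalVec θ c 0) ⬝ᵥ conditionalVec θ c 1

theorem inv_sqrt_two_mul_self : (((√2 : ℝ) : ℂ))⁻¹ * (((√2 : ℝ) : ℂ))⁻¹ = 1 / 2 := by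
  rw [← mul_inv, ← Complex.ofReal_mul, Real.mul_self_sqrt (by norm_num)]
  norm_num

theorem conditionalVec_norm {θ : Fin 2 × Fin 2 → ℂ} (hθ : IsUnitVector θ) (c : BB84) :
    star (conditionalVec θ c 0) ⬝ᵥ conditionalVec θ c 0 +
      star (conditionalVec θ c 1) ⬝ᵥ conditionalVec θ c 1 = 1 := by
  have h := inv_sqrt_two_mul_self
  rw [← hθ]
  cases c
  · simp [conditionalVec, bb84Vec, dotProduct, Fin.sum_univ_two, Fintype.sum_prod_type]
    ring
  · simp [conditionalVec, bb84Vec, hadamard, dotProduct, Fin.sum_univ_two, Fintype.sum_prod_type,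
      Matrix.mulVec]
    linear_combination 2 * (θ (0, 0) * (starRingEnd ℂ) (θ (0, 0)) +
      θ (0, 1) * (starRingEnd ℂ) (θ (0, 1)) + θ (1, 0) * (starRingEnd ℂ) (θ (1, 0)) +
      θ (1, 1) * (starRingEnd ℂ) (θ (1, 1))) * h

theorem overlap_plus (θ : Fin 2 × Fin 2 → ℂ) :
    overlap θ .plus = traceFst (ketbra θ) 1 0 := by
  simp [overlap, conditionalVec, bb84Vec, dotProduct, Fin.sum_univ_two, traceFst, ketbra,
    Matrix.vecMulVec_apply]
  ring

theorem overlap_times (θ : Fin 2 × Fin 2 → ℂ) :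
    overlap θ .times = (traceFst (ketbra θ) 0 0 - traceFst (ketbra θ) 1 1
      + traceFst (ketbra θ) 0 1 - traceFst (ketbra θ) 1 0) / 2 := by
  have h := inv_sqrt_two_mul_self
  simp [overlap, conditionalVec, bb84Vec, hadamard, dotProduct, Fin.sum_univ_two, traceFst, ketbra,
    Matrix.vecMulVec_apply, Matrix.mulVec]
  linear_combination (θ (0, 0) * (starRingEnd ℂ) (θ (0, 0)) -
      θ (0, 1) * (starRingEnd ℂ) (θ (0, 1)) + θ (1, 0) * (starRingEnd ℂ) (θ (1, 0)) -
      θ (1, 1) * (starRingEnd ℂ) (θ (1, 1)) + θ (0, 0) * (starRingEnd ℂ) (θ (0, 1))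
      - θ (0, 1) * (starRingEnd ℂ) (θ (0, 0)) + θ (1, 0) * (starRingEnd ℂ) (θ (1, 1))
      - θ (1, 1) * (starRingEnd ℂ) (θ (1, 0))) * h

theorem isDensity_traceFst_ketbra {a b : Type} [Fintype a] [Fintype b] {θ : a × b → ℂ}
    (hθ : IsUnitVector θ) : IsDensity (traceFst (ketbra θ)) :=
  ⟨traceFst_posSemidef (ketbra_posSemidef θ), by rw [trace_traceFst, trace_ketbra]; exact hθ⟩

/-- The uncertainty relation between the two bases. -/
theorem quarter_sub_det_le_overlaps {θ : Fin 2 × Fin 2 → ℂ} (hθ : IsUnitVector θ) :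
    1 / 4 - (traceFst (ketbra θ)).det.re ≤
      Complex.normSq (overlap θ .plus) + Complex.normSq (overlap θ .times) := by
  obtain ⟨hσ, htr⟩ := isDensity_traceFst_ketbra hθ
  rw [overlap_plus, overlap_times]
  set σ := traceFst (ketbra θ)
  have h01 : σ 0 1 = star (σ 1 0) := (hσ.1.apply 0 1).symm
  have h0 := (Complex.nonneg_iff.mp (hσ.diag_nonneg (i := 0))).2
  have h1 := (Complex.nonneg_iff.mp (hσ.diag_nonneg (i := 1))).2
  have ht : (σ 0 0).re + (σ 1 1).re = 1 := by
    simpa [Matrix.trace, Fin.sum_univ_two] using congrArg Complex.re htr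
  rw [Matrix.det_fin_two, h01]
  simp [Complex.normSq_apply, ← h0, ← h1]
  -- At trace one, `1/4 - det σ = ((σ₀₀ - σ₁₁) / 2)² + |σ₁₀|²`; the overlaps exceed this by exactly
  -- `(Im σ₁₀)²`.
  nlinarith [sq_nonneg (σ 1 0).im]

/-- The bound on the probability of guessing a single outcome. -/
def guessBound (ε : ℝ) : ℝ := if ε < 1 then 3 / 4 + √(1 - 2 * (ε - ε ^ 2)) / 4 else 1 / 2

theorem guessBound_pos (ε : ℝ) : 0 < guessBound ε := by
  unfold guessBound
  split_ifs <;> positivity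

/-- For `0 < ε < 1` the quantity `ε - ε ^ 2` is positive. For `ε ≥ 1` the square-root formula would
not be below one, but no state has `F² < 1 - ε` then, so any value in `(0, 1)` serves. -/
theorem guessBound_lt_one {ε : ℝ} (hε : 0 < ε) : guessBound ε < 1 := by
  unfold guessBound
  split_ifs with h
  · have : √(1 - 2 * (ε - ε ^ 2)) < 1 := by
      rw [Real.sqrt_lt' one_pos]
      nlinarith
    linarith
  · norm_num

/-- Operators dominating the conditional states of `P` in both bases, with small average trace. -/
theorem exists_dominating_family {θ : Fin 2 × Fin 2 → ℂ} (hθ : IsUnitVector θ) {ε : ℝ}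
    (hε : 0 < ε) (hF : fidelity (traceFst (ketbra θ)) eprReference ^ 2 < 1 - ε) :
    ∃ K : BB84 → Op (Fin 2), (∀ c, (K c).PosSemidef) ∧
      (∀ c x, (K c - ketbra (conditionalVec θ c x)).PosSemidef) ∧
      (∑ c, (K c).trace.re) / 2 ≤ guessBound ε := by
  choose K hK hK0 hK1 htr using fun c => exists_dominating_op (conditionalVec_norm hθ c)
  refine ⟨K, hK, fun c x => ?_, ?_⟩
  · fin_cases x
    exacts [hK0 c, hK1 c]
  · obtain ⟨hε2, hdet⟩ := det_lt_of_fidelity_lt (isDensity_traceFst_ketbra hθ) hF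
    have hov := quarter_sub_det_le_overlaps hθ
    have hsum : ∑ c, (K c).trace.re = (K .plus).trace.re + (K .times).trace.re := by
      rw [show (Finset.univ : Finset BB84) = {.plus, .times} from rfl, Finset.sum_pair (by simp)]
    have h1 : ∀ c, √(1 - 4 * Complex.normSq (overlap θ c)) ≤ 1 := fun c =>
      Real.sqrt_le_one.mpr (by linarith [Complex.normSq_nonneg (overlap θ c)])
    have h2 : ∀ c, (ε - ε ^ 2) / 2 ≤ Complex.normSq (overlap θ c) →
        √(1 - 4 * Complex.normSq (overlap θ c)) ≤ √(1 - 2 * (ε - ε ^ 2)) := fun c h =>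
      Real.sqrt_le_sqrt (by linarith)
    rw [hsum, htr, htr, guessBound, if_pos (by linarith)]
    change ((1 + √(1 - 4 * Complex.normSq (overlap θ _))) / 2 +
      (1 + √(1 - 4 * Complex.normSq (overlap θ _))) / 2) / 2 ≤ _
    -- The larger squared overlap is at least half of `1/4 - (1/2 - ε)² = ε - ε²`; in the other
    -- basis the trivial bound `1` is used.
    rcases le_total (Complex.normSq (overlap θ .plus)) (Complex.normSq (overlap θ .times))
      with h | h
    · linarith [h1 .plus, h2 .times (by nlinarith)]
    · linarith [h1 .times, h2 .plus (by nlinarith)]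

/-! ### Sampling with the operators of a strategy eliminated -/

section Sampling

variable {S : Type} {n k : ℕ}

theorem mergeRegisters_samplePositions_inl (t : Sample n k) (a : Fin k → S) (b : Fin n → S)
    (i : Fin k) : mergeRegisters t a b (samplePositions t (.inl i)) = a i := by
  simp [mergeRegisters]

theorem mergeRegisters_samplePositions_inr (t : Sample n k) (a : Fin k → S) (b : Fin n → S)
    (j : Fin n) : mergeRegisters t a b (samplePositions t (.inr j)) = b j := by
  simp [mergeRegisters]

/-- The operator on the unsampled registers left after applying `F` to the sampled ones. -/
def sampledTrace [Fintype S] (t : Sample n k) (F : Op (Fin k → S)) (Y : Op (Fin (n + k) → S)) :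
    Op (Fin n → S) :=
  Matrix.of fun b b' => ∑ a, ∑ a', F a a' * Y (mergeRegisters t a' b) (mergeRegisters t a b')

/-- The operator on Paul's register left after applying `F` to the sampled registers and
discarding the others. -/
def sampledMarginal {R : Type} [Fintype S] (t : Sample n k) (F : Op (Fin k → S))
    (X : Op (R × (Fin (n + k) → S))) : Op R :=
  Matrix.of fun p p' => ∑ b, ∑ a, ∑ a',
    F a a' * X (p, mergeRegisters t a' b) (p', mergeRegisters t a b)

/-- The subnormalized state of `S^N` when Paul answers `x`. -/
def outcomeOp {R C Q : Type} [Fintype R] [Fintype Q] (A : Strategy R C Q n k) (t : Sample n k)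
    (c : C) (x : Q) (ρ : Op (R × (Fin (n + k) → S))) : Op (Fin (n + k) → S) :=
  Matrix.of fun s s' => A.op t c (Matrix.of fun r r' => ρ (r, s) (r', s')) x x

theorem outcomeOp_posSemidef {R C Q : Type} [Fintype R] [Fintype Q] [Fintype S] [DecidableEq S]
    (A : Strategy R C Q n k) (t : Sample n k) (c : C) (x : Q) {ρ : Op (R × (Fin (n + k) → S))}
    (hρ : ρ.PosSemidef) : (outcomeOp A t c x ρ).PosSemidef := by
  -- Complete positivity is stated for ancillas `Fin m` only, so `S^N` is relabelled.
  let e := Fintype.equivFin (Fin (n + k) → S)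
  have h := A.completelyPositive t c _ (ρ.submatrix (Prod.map id e.symm) (Prod.map id e.symm))
    (hρ.submatrix _)
  have h' := h.submatrix (fun s => (x, e s))
  convert h' using 1
  ext s s'
  simp [outcomeOp, tensorId]

theorem sum_outcomeOp {R C Q : Type} [Fintype R] [Fintype Q] (A : Strategy R C Q n k)
    (t : Sample n k) (c : C) (ρ : Op (R × (Fin (n + k) → S))) :
    ∑ x, outcomeOp A t c x ρ = traceFst ρ := by
  ext s s'
  rw [Matrix.sum_apply]
  exact A.tracePreserving t c (Matrix.of fun r r' => ρ (r, s) (r', s'))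

/-- Paul and Sam act on different registers, so Sam's measurement may be carried out first and
Paul's operation applied to what remains on `R`. -/
theorem trace_sampledTrace_outcomeOp {R C Q : Type} [Fintype R] [Fintype Q] [Fintype S]
    (A : Strategy R C Q n k) (t : Sample n k) (c : C) (x : Q) (F : Op (Fin k → S))
    (ρ : Op (R × (Fin (n + k) → S))) :
    (sampledTrace t F (outcomeOp A t c x ρ)).trace =
      A.op t c (sampledMarginal t F ρ) x x := by
  have h : sampledMarginal t F ρ = ∑ b, ∑ a, ∑ a', F a a' •
      Matrix.of fun r r' => ρ (r, mergeRegisters t a' b) (r', mergeRegisters t a b) := by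
    ext p p'
    simp [sampledMarginal, Matrix.sum_apply]
  rw [h]
  simp only [map_sum, map_smul, Matrix.sum_apply, Matrix.smul_apply, smul_eq_mul]
  rfl

end Sampling

theorem eprAccept_apply {k : ℕ} (c : Fin k → BB84) (q q' a a' : Fin k → Fin 2) :
    eprAccept c (q, a) (q', a') = if q = q' then bb84Proj c q a a' else 0 := by
  rw [eprAccept, Matrix.sum_apply]
  simp only [Matrix.kroneckerMap_apply, ketbra, Matrix.vecMulVec_apply, Pi.star_apply,
    Pi.single_apply]
  rw [Finset.sum_eq_single q]
  · by_cases h : q = q'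
    · simp [h]
    · simp [h, Ne.symm h]
  · intro x _ hx
    simp [hx.symm]
  · simp

theorem accOutput_eprLOCC {n k : ℕ} {R : Type} [Fintype R]
    (A : Strategy R (Fin k → BB84) (Fin k → Fin 2) n k) (ρ : Op (R × (Fin (n + k) → Fin 2))) :
    accOutput (eprLOCC n k) A ρ =
      ((((n + k).choose k : ℝ)⁻¹ * ((2 : ℝ) ^ k)⁻¹ : ℝ) : ℂ) • ∑ t, ∑ c, ∑ x,
        sampledTrace t (bb84Proj c x) (outcomeOp A t c x ρ) := by
  rw [accOutput, Finset.smul_sum]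
  refine Finset.sum_congr rfl fun t _ => ?_
  rw [Finset.smul_sum]
  refine Finset.sum_congr rfl fun c _ => ?_
  congr 1
  ext b b'
  simp only [traceFst, eprLOCC, Matrix.of_apply, Matrix.mul_apply, Matrix.kroneckerMap_apply,
    Matrix.submatrix_apply, Fintype.sum_prod_type, eprAccept_apply, Matrix.one_apply, mul_ite,
    mul_one, mul_zero, ite_mul, zero_mul, Finset.sum_ite_eq, Finset.mem_univ, if_true,
    Matrix.sum_apply, sampledTrace]
  refine Finset.sum_congr rfl fun x _ => Finset.sum_congr rfl fun a _ => ?_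
  rw [Finset.sum_comm]
  refine Finset.sum_congr rfl fun a' _ => ?_
  simp [outcomeOp, tensorId]

/-! ### I.i.d. states -/

section Iid

variable {P S : Type} {n k : ℕ}

theorem iidVec_mergeRegisters (θ : P × S → ℂ) (t : Sample n k) (p : Fin (n + k) → P)
    (a : Fin k → S) (b : Fin n → S) :
    iidVec (n + k) θ (p, mergeRegisters t a b) =
      (∏ i, θ (p (samplePositions t (.inl i)), a i)) *
        ∏ j, θ (p (samplePositions t (.inr j)), b j) := by
  rw [iidVec, ← (samplePositions t).prod_comp, Fintype.prod_sum_type]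
  simp only [mergeRegisters_samplePositions_inl, mergeRegisters_samplePositions_inr]

/-- The reduced state on the first register of a pure state. -/
def reducedFst [Fintype S] (θ : P × S → ℂ) : Op P := ∑ s, ketbra fun p => θ (p, s)

theorem reducedFst_posSemidef [Fintype P] [Fintype S] (θ : P × S → ℂ) : (reducedFst θ).PosSemidef :=
  Matrix.posSemidef_sum _ fun _ _ => ketbra_posSemidef _

theorem trace_reducedFst [Fintype P] [Fintype S] {θ : P × S → ℂ} (hθ : IsUnitVector θ) :
    (reducedFst θ).trace = 1 := by
  rw [← hθ, reducedFst, Matrix.trace_sum]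
  simp only [trace_ketbra, dotProduct, Fintype.sum_prod_type, Pi.star_apply]
  exact Finset.sum_comm

end Iid

/-- Sam's effect is a product projector, so each sampled pair collapses to its conditional vector,
while tracing out an unsampled `S` leaves the reduced state of `P`. -/
theorem sampledMarginal_iid {n k : ℕ} (θ : Fin 2 × Fin 2 → ℂ) (t : Sample n k)
    (c : Fin k → BB84) (x : Fin k → Fin 2) :
    sampledMarginal t (bb84Proj c x) (ketbra (iidVec (n + k) θ)) =
      (piTensor (Sum.elim (fun i => ketbra (conditionalVec θ (c i) (x i)))
        fun _ : Fin n => reducedFst θ)).submatrix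
          (fun p => p ∘ samplePositions t) (fun p => p ∘ samplePositions t) := by
  ext p p'
  have hamp : ∀ q : Fin k → Fin 2,
      ∑ a : Fin k → Fin 2, (∏ i, star (bb84Vec (c i) (x i) (a i))) * ∏ i, θ (q i, a i) =
        ∏ i, conditionalVec θ (c i) (x i) (q i) := by
    intro q
    simp only [← Finset.prod_mul_distrib, conditionalVec]
    rw [Fintype.prod_sum]
  simp only [Matrix.submatrix_apply, piTensor, Matrix.of_apply, Fintype.prod_sum_type,
    Sum.elim_inl, Sum.elim_inr, Function.comp_apply, ketbra, Matrix.vecMulVec_apply,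
    Pi.star_apply, reducedFst, Matrix.sum_apply, Finset.prod_mul_distrib]
  rw [Fintype.prod_sum]
  simp only [← hamp, ← star_prod, Finset.prod_mul_distrib]
  rw [Finset.mul_sum]
  simp only [sampledMarginal, Matrix.of_apply, ketbra, bb84Proj, Matrix.vecMulVec_apply,
    Pi.star_apply, iidVec_mergeRegisters]
  refine Finset.sum_congr rfl fun b _ => ?_
  rw [star_sum, Finset.sum_mul_sum, Finset.sum_comm, Finset.sum_mul]
  refine Finset.sum_congr rfl fun a _ => ?_
  rw [Finset.sum_mul]
  refine Finset.sum_congr rfl fun a' _ => ?_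
  simp only [star_mul', star_star]
  ring

theorem trace_submatrix_equiv {a b : Type} [Fintype a] [Fintype b] (X : Op a) (e : b ≃ a) :
    (X.submatrix e e).trace = X.trace := by
  simp only [Matrix.trace, Matrix.diag, Matrix.submatrix_apply]
  exact e.sum_comp fun i => X i i

theorem posSemidef_trace_eq_ofReal {a : Type} [Fintype a] {A : Op a} (hA : A.PosSemidef) :
    A.trace = (A.trace.re : ℂ) :=
  Complex.ext rfl (by simpa using (Complex.nonneg_iff.mp hA.trace_nonneg).2.symm)

/-- Multiplicativity of the bound on the guessing probability, for fixed sample and bases. -/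
theorem sum_functional_iid_le {n k : ℕ} {θ : Fin 2 × Fin 2 → ℂ} (hθ : IsUnitVector θ)
    {K : BB84 → Op (Fin 2)} (hK : ∀ c, (K c).PosSemidef)
    (hKθ : ∀ c x, (K c - ketbra (conditionalVec θ c x)).PosSemidef)
    (t : Sample n k) (c : Fin k → BB84)
    {L : (Fin k → Fin 2) → Op (Fin (n + k) → Fin 2) →ₗ[ℂ] ℂ}
    (hpos : ∀ x (Y : Op (Fin (n + k) → Fin 2)), Y.PosSemidef → 0 ≤ (L x Y).re)
    (hsum : ∀ Y : Op (Fin (n + k) → Fin 2), Y.PosSemidef → ∑ x, (L x Y).re ≤ Y.trace.re) :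
    ∑ x, (L x (sampledMarginal t (bb84Proj c x) (ketbra (iidVec (n + k) θ)))).re ≤
      ∏ i, (K (c i)).trace.re := by
  let e : (Fin (n + k) → Fin 2) ≃ (Fin k ⊕ Fin n → Fin 2) :=
    (samplePositions t).symm.arrowCongr (Equiv.refl _)
  -- At unsampled positions the state dominates itself and has trace one, so only the `k` sampled
  -- factors count. `F` does not depend on the answer `x`, as duality requires.
  let F : Fin k ⊕ Fin n → Op (Fin 2) := Sum.elim (fun i => K (c i)) fun _ => reducedFst θ
  have hF : ∀ i, (F i).PosSemidef := by
    rintro (i | j)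
    exacts [hK _, reducedFst_posSemidef θ]
  have htr : ((piTensor F).submatrix e e).trace.re = ∏ i, (K (c i)).trace.re := by
    rw [trace_submatrix_equiv, trace_piTensor, Fintype.prod_sum_type]
    simp only [F, Sum.elim_inl, Sum.elim_inr, trace_reducedFst hθ, Finset.prod_const_one, mul_one]
    rw [Finset.prod_congr rfl fun i _ => posSemidef_trace_eq_ofReal (hK (c i)),
      ← Complex.ofReal_prod, Complex.ofReal_re]
  rw [← htr]
  refine sum_functional_le_trace hpos hsum ((piTensor_posSemidef hF).submatrix e) fun x => ?_
  rw [sampledMarginal_iid]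
  refine (piTensor_sub_posSemidef ?_ ?_).submatrix e
  · rintro (i | j)
    exacts [ketbra_posSemidef _, reducedFst_posSemidef θ]
  · rintro (i | j)
    · exact hKθ _ _
    · simpa [F] using Matrix.PosSemidef.zero

/-- The bound on the acceptance probability on i.i.d. states, for a fixed sample. -/
theorem average_functional_iid_le {n k : ℕ} {θ : Fin 2 × Fin 2 → ℂ} (hθ : IsUnitVector θ) {ε : ℝ}
    (hε : 0 < ε) (hF : fidelity (traceFst (ketbra θ)) eprReference ^ 2 < 1 - ε) (t : Sample n k)
    {L : (Fin k → BB84) → (Fin k → Fin 2) → Op (Fin (n + k) → Fin 2) →ₗ[ℂ] ℂ}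
    (hpos : ∀ c x (Y : Op (Fin (n + k) → Fin 2)), Y.PosSemidef → 0 ≤ (L c x Y).re)
    (hsum : ∀ c (Y : Op (Fin (n + k) → Fin 2)), Y.PosSemidef →
      ∑ x, (L c x Y).re ≤ Y.trace.re) :
    ((2 : ℝ) ^ k)⁻¹ * ∑ c, ∑ x,
      (L c x (sampledMarginal t (bb84Proj c x) (ketbra (iidVec (n + k) θ)))).re ≤
        guessBound ε ^ k := by
  obtain ⟨K, hK, hKθ, hle⟩ := exists_dominating_family hθ hε hF
  have h1 : ∑ c : Fin k → BB84, ∏ i, (K (c i)).trace.re = (∑ c, (K c).trace.re) ^ k := by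
    rw [← Fintype.prod_sum (fun (_ : Fin k) c => (K c).trace.re)]
    simp
  calc _ ≤ ((2 : ℝ) ^ k)⁻¹ * ∑ c : Fin k → BB84, ∏ i, (K (c i)).trace.re :=
        mul_le_mul_of_nonneg_left (Finset.sum_le_sum fun c _ =>
          sum_functional_iid_le hθ hK hKθ t c (hpos c) (hsum c)) (by positivity)
    _ = ((∑ c, (K c).trace.re) / 2) ^ k := by rw [h1, div_pow]; ring
    _ ≤ guessBound ε ^ k := pow_le_pow_left₀
        (div_nonneg (Finset.sum_nonneg fun c _ => posSemidef_trace_re_nonneg (hK c)) two_pos.le)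
        hle k

theorem card_sample (n k : ℕ) : Fintype.card (Sample n k) = (n + k).choose k := by
  rw [Fintype.card_finset_len, Fintype.card_fin]

theorem strategy_op_posSemidef {R C Q : Type} [Fintype R] [Fintype Q] {n k : ℕ}
    (A : Strategy R C Q n k) (t : Sample n k) (c : C) {Y : Op R} (hY : Y.PosSemidef) :
    (A.op t c Y).PosSemidef :=
  -- Positivity is complete positivity with a one-dimensional ancilla.
  (A.completelyPositive t c 1 (Y.submatrix Prod.fst Prod.fst) (hY.submatrix _)).submatrix
    fun q => (q, 0)

theorem accOutput_iid_trace_le {n k : ℕ} {θ : Fin 2 × Fin 2 → ℂ} (hθ : IsUnitVector θ) {ε : ℝ}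
    (hε : 0 < ε) (hF : fidelity (traceFst (ketbra θ)) eprReference ^ 2 < 1 - ε)
    (A : Strategy (Fin (n + k) → Fin 2) (Fin k → BB84) (Fin k → Fin 2) n k) :
    (accOutput (eprLOCC n k) A (ketbra (iidVec (n + k) θ))).trace.re ≤ guessBound ε ^ k := by
  have hchoose : (0 : ℝ) < (n + k).choose k := by
    exact_mod_cast Nat.choose_pos (Nat.le_add_left k n)
  rw [accOutput_eprLOCC, Matrix.trace_smul, smul_eq_mul, Complex.re_ofReal_mul]
  simp only [Matrix.trace_sum, Complex.re_sum, trace_sampledTrace_outcomeOp]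
  rw [mul_assoc, Finset.mul_sum, inv_mul_le_iff₀ hchoose]
  have hcard : ((n + k).choose k : ℝ) * guessBound ε ^ k =
      ∑ _t : Sample n k, guessBound ε ^ k := by
    rw [Finset.sum_const, Finset.card_univ, card_sample, nsmul_eq_mul]
  rw [hcard]
  refine Finset.sum_le_sum fun t _ => ?_
  refine average_functional_iid_le hθ hε hF t
    -- Only the diagonal entries of Paul's output matter, since his message is read classically;
    -- together they form a measurement of `P^N`.
    (L := fun c x => (Matrix.entryLinearMap ℂ ℂ x x).comp (A.op t c)) ?_ ?_
  · exact fun c x Y hY =>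
      (Complex.nonneg_iff.mp ((strategy_op_posSemidef A t c hY).diag_nonneg (i := x))).1
  · intro c Y _
    rw [← A.tracePreserving t c Y, Matrix.trace, Complex.re_sum]
    rfl

theorem guessProb_le {θ : Fin 2 × Fin 2 → ℂ} (hθ : IsUnitVector θ) {ε : ℝ}
    (hε : 0 < ε) (hF : fidelity (traceFst (ketbra θ)) eprReference ^ 2 < 1 - ε)
    {E : BB84 → Fin 2 → Op (Fin 2)} (hE : ∀ c, IsPOVM (E c)) :
    guessProb E θ ≤ guessBound ε := by
  obtain ⟨K, hK, hKθ, hle⟩ := exists_dominating_family hθ hε hF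
  have h1 : ∀ c x, ((E c x ⊗ₖ ketbra (bb84Vec c x)) * ketbra θ).trace =
      (E c x * ketbra (conditionalVec θ c x)).trace := by
    intro c x
    simp [Matrix.trace, Matrix.mul_apply, Fintype.sum_prod_type, Fin.sum_univ_two, ketbra,
      Matrix.vecMulVec_apply, conditionalVec]
    ring
  have h2 : ∀ c, ∑ x, ((E c x ⊗ₖ ketbra (bb84Vec c x)) * ketbra θ).trace.re ≤
      (K c).trace.re := by
    intro c
    simp only [h1]
    refine sum_functional_le_trace
      (L := fun x => (Matrix.traceLinearMap (Fin 2) ℂ ℂ).comp (LinearMap.mulLeft ℂ (E c x)))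
      (fun x Y hY => posSemidef_trace_mul_re_nonneg ((hE c).1 x) hY) (fun Y _ => ?_) (hK c) (hKθ c)
    change ∑ x, (E c x * Y).trace.re ≤ _
    rw [← Complex.re_sum, ← Matrix.trace_sum, ← Finset.sum_mul, (hE c).2, Matrix.one_mul]
  rw [guessProb]
  linarith [Finset.sum_le_sum fun c (_ : c ∈ Finset.univ) => h2 c]

/-! ### Permutations of the positions -/

section Permutations

variable {n k : ℕ}

theorem mem_sample_iff (t : Sample n k) (i : Fin (n + k)) :
    i ∈ t.1 ↔ ((samplePositions t).symm i).isLeft := by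
  obtain ⟨y, rfl⟩ := (samplePositions t).surjective i
  rw [Equiv.symm_apply_apply]
  rcases y with j | j
  · simp [samplePositions, finSumEquivOfFinset_inl, Finset.orderEmbOfFin_mem]
  · simp only [samplePositions, finSumEquivOfFinset_inr, Sum.isLeft_inr, Bool.false_eq_true,
      iff_false]
    exact Finset.mem_compl.mp (Finset.orderEmbOfFin_mem _ _ _)

/-- The permutation of the positions that carries the sample `t` to `t₀`, permuting the sampled
positions by `κ` and the unsampled ones by `π`. -/
def samplePerm (t₀ t : Sample n k) (κ : Equiv.Perm (Fin k)) (π : Equiv.Perm (Fin n)) :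
    Equiv.Perm (Fin (n + k)) :=
  (samplePositions t).symm.trans ((Equiv.sumCongr κ π).trans (samplePositions t₀))

theorem mergeRegisters_comp_samplePerm {S : Type} (t₀ t : Sample n k) (κ : Equiv.Perm (Fin k))
    (π : Equiv.Perm (Fin n)) (a : Fin k → S) (b : Fin n → S) :
    mergeRegisters t₀ a b ∘ samplePerm t₀ t κ π = mergeRegisters t (a ∘ κ) (b ∘ π) := by
  funext i
  simp only [mergeRegisters, samplePerm, Function.comp_apply, Equiv.trans_apply,
    Equiv.symm_apply_apply, Equiv.sumCongr_apply]
  rcases (samplePositions t).symm i with j | j <;> rfl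

/-- The sample `t` is recovered as the preimage of `t₀`; then `κ` and `π` are the restrictions to
the sampled and the unsampled slots. -/
theorem samplePerm_injective (t₀ : Sample n k) : Function.Injective
    fun u : Sample n k × Equiv.Perm (Fin k) × Equiv.Perm (Fin n) =>
      samplePerm t₀ u.1 u.2.1 u.2.2 := by
  rintro ⟨t, κ, π⟩ ⟨t', κ', π'⟩ h
  have h1 : ∀ i, Sum.map κ π ((samplePositions t).symm i) =
      Sum.map κ' π' ((samplePositions t').symm i) := by
    intro i
    have := Equiv.congr_fun h i
    simpa [samplePerm] using this
  have ht : t = t' := by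
    apply Subtype.ext
    ext i
    rw [mem_sample_iff, mem_sample_iff]
    have := congrArg Sum.isLeft (h1 i)
    rw [Sum.isLeft_map, Sum.isLeft_map] at this
    rw [this]
  subst ht
  have h2 : ∀ y, Sum.map κ π y = Sum.map κ' π' y := fun y => by
    simpa using h1 (samplePositions t y)
  have hκ : κ = κ' := Equiv.ext fun j => by simpa using h2 (.inl j)
  have hπ : π = π' := Equiv.ext fun j => by simpa using h2 (.inr j)
  rw [hκ, hπ]

theorem samplePerm_bijective (t₀ : Sample n k) : Function.Bijective
    fun u : Sample n k × Equiv.Perm (Fin k) × Equiv.Perm (Fin n) =>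
      samplePerm t₀ u.1 u.2.1 u.2.2 := by
  rw [Fintype.bijective_iff_injective_and_card]
  refine ⟨samplePerm_injective t₀, ?_⟩
  rw [Fintype.card_prod, Fintype.card_prod, card_sample, Fintype.card_perm, Fintype.card_perm,
    Fintype.card_perm, Fintype.card_fin, Fintype.card_fin, Fintype.card_fin, ← mul_assoc]
  simpa using Nat.choose_mul_factorial_mul_factorial (Nat.le_add_left k n)

/-- This trades Sam's random sample for a fixed one: averaging over all permutations includes
drawing `t` uniformly. -/
theorem sum_samplePerm {M : Type} [AddCommMonoid M] (t₀ : Sample n k)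
    (f : Equiv.Perm (Fin (n + k)) → M) :
    ∑ t, ∑ κ, ∑ π, f (samplePerm t₀ t κ π) = ∑ ν, f ν := by
  rw [← (samplePerm_bijective t₀).sum_comp f]
  simp only [Fintype.sum_prod_type]

/-- Splitting the registers into the sampled and the unsampled ones. -/
def mergeEquiv (S : Type) (t : Sample n k) : (Fin k → S) × (Fin n → S) ≃ (Fin (n + k) → S) where
  toFun u := mergeRegisters t u.1 u.2
  invFun s := (fun i => s (samplePositions t (.inl i)), fun j => s (samplePositions t (.inr j)))
  left_inv u := by
    simp only [mergeRegisters_samplePositions_inl, mergeRegisters_samplePositions_inr]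
  right_inv s := by
    funext i
    obtain ⟨y, rfl⟩ := (samplePositions t).surjective i
    rcases y with j | j
    · exact mergeRegisters_samplePositions_inl t _ _ j
    · exact mergeRegisters_samplePositions_inr t _ _ j

end Permutations

section Symmetrization

variable {S : Type} [Fintype S] [DecidableEq S] {m : ℕ}

theorem permOp_mul_apply (ν : Equiv.Perm (Fin m)) (Y : Op (Fin m → S)) (a b : Fin m → S) :
    (permOp S ν * Y) a b = Y (a ∘ ν) b := by
  rw [Matrix.mul_apply, Finset.sum_eq_single (a ∘ ν)]
  · simp [permOp, Function.comp_assoc]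
  · intro x _ hx
    have : a ≠ x ∘ ν.symm := fun h => hx (by rw [h]; funext i; simp)
    simp [permOp, this]
  · simp

theorem mul_permOp_apply (ν : Equiv.Perm (Fin m)) (Y : Op (Fin m → S)) (a b : Fin m → S) :
    (Y * permOp S ν) a b = Y a (b ∘ ν.symm) := by
  simp [Matrix.mul_apply, permOp]

theorem permOp_conj_apply (ν : Equiv.Perm (Fin m)) (Y : Op (Fin m → S)) (a b : Fin m → S) :
    (permOp S ν * Y * (permOp S ν)ᴴ) a b = Y (a ∘ ν) (b ∘ ν) := by
  have h : (permOp S ν)ᴴ = permOp S ν.symm := by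
    ext a b
    have : b = a ∘ ν.symm ↔ a = b ∘ ν := by
      constructor <;> rintro rfl <;> funext i <;> simp
    simp [permOp, Matrix.conjTranspose_apply, this, apply_ite]
  rw [h, mul_permOp_apply, permOp_mul_apply, Equiv.symm_symm]

theorem symmetrize_apply (σ : Op (Fin m → S)) (a b : Fin m → S) :
    symmetrize σ a b = (m.factorial : ℂ)⁻¹ * ∑ ν : Equiv.Perm (Fin m), σ (a ∘ ν) (b ∘ ν) := by
  simp only [symmetrize, Matrix.smul_apply, Matrix.sum_apply, permOp_conj_apply, smul_eq_mul]

theorem symmetrize_posSemidef {σ : Op (Fin m → S)} (hσ : σ.PosSemidef) :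
    (symmetrize σ).PosSemidef :=
  (Matrix.posSemidef_sum _ fun ν _ => hσ.mul_mul_conjTranspose_same (permOp S ν)).smul
    (by rw [inv_nonneg]; exact Nat.cast_nonneg _)

theorem symmetrize_comm_permOp (σ : Op (Fin m → S)) (ν : Equiv.Perm (Fin m)) :
    Commute (symmetrize σ) (permOp S ν) := by
  ext a b
  rw [mul_permOp_apply, permOp_mul_apply, symmetrize_apply, symmetrize_apply]
  congr 1
  refine (Equiv.sum_comp (Equiv.mulLeft ν) _).symm.trans (Finset.sum_congr rfl fun π _ => ?_)
  congr 1
  funext i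
  simp

theorem symmetrizeWithRecord_apply (σ : Op (Fin m → S)) (u v : Equiv.Perm (Fin m) × (Fin m → S)) :
    symmetrizeWithRecord σ u v =
      if u.1 = v.1 then (m.factorial : ℂ)⁻¹ * σ (u.2 ∘ u.1) (v.2 ∘ u.1) else 0 := by
  obtain ⟨π, a⟩ := u
  obtain ⟨π', b⟩ := v
  simp only [symmetrizeWithRecord, Matrix.smul_apply, Matrix.sum_apply, Matrix.kroneckerMap_apply,
    permOp_conj_apply, ketbra, Matrix.vecMulVec_apply, Pi.star_apply, Pi.single_apply, smul_eq_mul]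
  rw [Finset.sum_eq_single π]
  · by_cases h : π = π'
    · simp [h]
    · simp [h, Ne.symm h]
  · intro x _ hx
    simp [hx.symm]
  · simp

/-- The canonical purification of a Hermitian square `T * T`. -/
def canonicalPurification {a : Type} (T : Op a) : a × a → ℂ := fun u => T u.2 u.1

theorem traceFst_canonicalPurification {a : Type} [Fintype a] {T : Op a} (hT : T.IsHermitian) :
    traceFst (ketbra (canonicalPurification T)) = T * T := by
  ext s s'
  simp only [traceFst, ketbra, Matrix.vecMulVec_apply, Matrix.of_apply, Pi.star_apply,
    canonicalPurification, Matrix.mul_apply]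
  exact Finset.sum_congr rfl fun p _ => by rw [hT.apply]

/-- Permuting both halves of the vectorization conjugates `T` by a permutation matrix; such matrices
are real, so no complex conjugate appears on the purifying side. -/
theorem canonicalPurification_symmetric {T : Op (Fin m → S)}
    (hT : ∀ ν : Equiv.Perm (Fin m), Commute T (permOp S ν)) :
    IsSymmetricVector (canonicalPurification T) := by
  intro ν
  funext u
  obtain ⟨p, s⟩ := u
  have h1 : ((permOp S ν ⊗ₖ permOp S ν) *ᵥ canonicalPurification T) (p, s) = T (s ∘ ν) (p ∘ ν) := by
    have h2 : ∀ (a b : Fin m → S), permOp S ν a b = if b = a ∘ ν then 1 else 0 := fun a b => by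
      have : a = b ∘ ν.symm ↔ b = a ∘ ν := by
        constructor <;> rintro rfl <;> funext i <;> simp
      simp [permOp, this]
    simp [Matrix.mulVec, dotProduct, Fintype.sum_prod_type, h2, canonicalPurification]
  rw [h1, ← permOp_mul_apply ν T s (p ∘ ν), ← (hT ν).eq, mul_permOp_apply]
  simp [canonicalPurification, Function.comp_assoc]

end Symmetrization

/-! ### Instruments -/

section Instruments

variable {a b r : Type} [Fintype a]

/-- The map `X ↦ tr_a ((W ⊗ 1) X)`. -/
def filterOp (W : Op a) (X : Op (a × b)) : Op b :=
  Matrix.of fun i j => ∑ x, ∑ x', W x x' * X (x', i) (x, j)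

/-- Writing `W = Vᴴ * V` gives a Kraus form with operators `⟨y|V ⊗ 1`. -/
theorem filterOp_posSemidef [Fintype b] {W : Op a} {X : Op (a × b)} (hW : W.PosSemidef)
    (hX : X.PosSemidef) : (filterOp W X).PosSemidef := by
  classical
  obtain ⟨V, rfl⟩ := posSemidef_exists_factor hW
  let B : a → Matrix b (a × b) ℂ := fun y => Matrix.of fun i u => if i = u.2 then V y u.1 else 0
  have h : filterOp (Vᴴ * V) X = ∑ y, B y * X * (B y)ᴴ := by
    ext i j
    simp only [filterOp, B, Matrix.of_apply, Matrix.sum_apply, Matrix.mul_apply,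
      Matrix.conjTranspose_apply, Fintype.sum_prod_type, ite_mul, zero_mul, Finset.sum_ite_eq,
      Finset.mem_univ, if_true, apply_ite star, star_zero, mul_ite, mul_zero, Finset.sum_mul]
    rw [Finset.sum_congr rfl fun x _ => Finset.sum_comm, Finset.sum_comm]
    refine Finset.sum_congr rfl fun y _ => Finset.sum_congr rfl fun x _ =>
      Finset.sum_congr rfl fun x' _ => ?_
    ring
  rw [h]
  exact Matrix.posSemidef_sum _ fun y _ => hX.mul_mul_conjTranspose_same (B y)

theorem filterOp_sum {ι : Type} (s : Finset ι) (W : ι → Op a) (X : Op (a × b)) :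
    filterOp (∑ i ∈ s, W i) X = ∑ i ∈ s, filterOp (W i) X := by
  ext i j
  simp only [filterOp, Matrix.of_apply, Matrix.sum_apply, Finset.sum_mul]
  rw [Finset.sum_congr rfl fun x _ => Finset.sum_comm, Finset.sum_comm]

theorem filterOp_smul (z : ℂ) (W : Op a) (X : Op (a × b)) :
    filterOp (z • W) X = z • filterOp W X := by
  ext i j
  simp only [filterOp, Matrix.of_apply, Matrix.smul_apply, smul_eq_mul, Finset.mul_sum, mul_assoc]

theorem filterOp_sub (W W' : Op a) (X : Op (a × b)) :
    filterOp (W - W') X = filterOp W X - filterOp W' X := by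
  ext i j
  simp only [filterOp, Matrix.of_apply, Matrix.sub_apply, sub_mul, Finset.sum_sub_distrib]

theorem filterOp_one [DecidableEq a] (X : Op (a × b)) : filterOp 1 X = traceFst X := by
  ext i j
  simp [filterOp, traceFst, Matrix.one_apply]

/-- The instrument with outcome recorded in the register `r`, whose outcome `z` has the POVM
element `W z`. -/
def instrument [DecidableEq r] (W : r → Op a) : Op (a × b) →ₗ[ℂ] Op (r × b) where
  toFun X := Matrix.of fun u v => if u.1 = v.1 then filterOp (W u.1) X u.2 v.2 else 0
  map_add' X Y := by
    ext u v
    by_cases h : u.1 = v.1 <;> simp [h, filterOp, mul_add, Finset.sum_add_distrib]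
  map_smul' z X := by
    ext u v
    by_cases h : u.1 = v.1
    · simp only [filterOp, Matrix.of_apply, Matrix.smul_apply, smul_eq_mul, h, if_true,
        RingHom.id_apply, Finset.mul_sum]
      exact Finset.sum_congr rfl fun x _ => Finset.sum_congr rfl fun x' _ => mul_left_comm _ _ _
    · simp [h]

variable [DecidableEq r]

theorem instrument_apply (W : r → Op a) (X : Op (a × b)) (u v : r × b) :
    instrument W X u v = if u.1 = v.1 then filterOp (W u.1) X u.2 v.2 else 0 := rfl

theorem instrument_posSemidef [Fintype b] [Fintype r] {W : r → Op a} {X : Op (a × b)}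
    (hW : ∀ z, (W z).PosSemidef) (hX : X.PosSemidef) : (instrument W X).PosSemidef := by
  have h : instrument W X = ∑ z, ketbra (Pi.single z 1) ⊗ₖ filterOp (W z) X := by
    ext ⟨z, i⟩ ⟨z', j⟩
    rw [instrument_apply, Matrix.sum_apply]
    simp only [Matrix.kroneckerMap_apply, ketbra, Matrix.vecMulVec_apply, Pi.star_apply,
      Pi.single_apply]
    rw [Finset.sum_eq_single z]
    · by_cases h : z = z'
      · simp [h]
      · simp [h, Ne.symm h]
    · intro y _ hy
      simp [hy.symm]
    · simp
  rw [h]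
  exact Matrix.posSemidef_sum _ fun z _ =>
    (ketbra_posSemidef _).kronecker (filterOp_posSemidef (hW z) hX)

/-- The instrument acts only on `a`, so an ancilla can be absorbed into `b`, and positivity for
every `b` suffices. -/
theorem instrument_completelyPositive [Fintype b] [Fintype r] {W : r → Op a}
    (hW : ∀ z, (W z).PosSemidef) :
    IsCompletelyPositive (instrument W : Op (a × b) →ₗ[ℂ] Op (r × b)) := by
  intro m X hX
  exact (instrument_posSemidef (b := b × Fin m) hW
    (hX.submatrix (Equiv.prodAssoc a b (Fin m)).symm)).submatrix (Equiv.prodAssoc r b (Fin m))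

theorem traceFst_instrument [Fintype r] (W : r → Op a) (X : Op (a × b)) :
    traceFst (instrument W X) = filterOp (∑ z, W z) X := by
  rw [filterOp_sum]
  ext i j
  simp [traceFst, instrument_apply, Matrix.sum_apply]

end Instruments

/-! ### Attacks with a fixed sample -/

section Regroup

variable {P S : Type} {n k : ℕ}

/-- Regrouping `P^N S^N` as the sampled part `P^N S_t` and the unsampled registers. -/
def regroup (P : Type) (S : Type) (t : Sample n k) :
    Op (P × (Fin (n + k) → S)) →ₗ[ℂ] Op ((P × (Fin k → S)) × (Fin n → S)) where
  toFun X := X.submatrix (fun u => (u.1.1, mergeRegisters t u.1.2 u.2))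
    (fun u => (u.1.1, mergeRegisters t u.1.2 u.2))
  map_add' _ _ := rfl
  map_smul' _ _ := rfl

theorem regroup_apply (t : Sample n k) (X : Op (P × (Fin (n + k) → S)))
    (u v : (P × (Fin k → S)) × (Fin n → S)) :
    regroup P S t X u v =
      X (u.1.1, mergeRegisters t u.1.2 u.2) (v.1.1, mergeRegisters t v.1.2 v.2) := rfl

theorem regroup_posSemidef (t : Sample n k) {X : Op (P × (Fin (n + k) → S))} (hX : X.PosSemidef) :
    (regroup P S t X).PosSemidef := hX.submatrix _

theorem isCompletelyPositive_comp_regroup {r : Type} (t : Sample n k)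
    {Φ : Op ((P × (Fin k → S)) × (Fin n → S)) →ₗ[ℂ] Op r} (hΦ : IsCompletelyPositive Φ) :
    IsCompletelyPositive (Φ.comp (regroup P S t)) := fun m _ hX =>
  hΦ m _ (hX.submatrix fun u : ((P × (Fin k → S)) × (Fin n → S)) × Fin m =>
    ((u.1.1.1, mergeRegisters t u.1.1.2 u.1.2), u.2))

variable [Fintype P] [Fintype S]

theorem trace_regroup (t : Sample n k) (X : Op (P × (Fin (n + k) → S))) :
    (regroup P S t X).trace = X.trace :=
  trace_submatrix_equiv X
    ((Equiv.prodAssoc _ _ _).trans ((Equiv.refl P).prodCongr (mergeEquiv S t)))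

/-- Paul's measurement taken first: this order identifies the output of the symmetrized attack. The
opposite order, in `trace_filterOp_kronecker_regroup`, serves the i.i.d. bound. -/
theorem filterOp_kronecker_regroup (t : Sample n k) (M : Op P) (F : Op (Fin k → S))
    (X : Op (P × (Fin (n + k) → S))) :
    filterOp (M ⊗ₖ F) (regroup P S t X) = sampledTrace t F (filterOp M X) := by
  ext b b'
  simp only [filterOp, sampledTrace, Matrix.of_apply, Matrix.kroneckerMap_apply, regroup_apply,
    Fintype.sum_prod_type, Finset.mul_sum]
  rw [Finset.sum_comm]
  refine Finset.sum_congr rfl fun a _ => ?_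
  rw [Finset.sum_congr rfl fun x _ => Finset.sum_comm, Finset.sum_comm]
  refine Finset.sum_congr rfl fun a' _ => Finset.sum_congr rfl fun p _ =>
    Finset.sum_congr rfl fun p' _ => ?_
  ring

theorem trace_filterOp_kronecker_regroup (t : Sample n k) (M : Op P) (F : Op (Fin k → S))
    (X : Op (P × (Fin (n + k) → S))) :
    (filterOp (M ⊗ₖ F) (regroup P S t X)).trace = (M * sampledMarginal t F X).trace := by
  simp only [filterOp, sampledMarginal, Matrix.trace, Matrix.diag, Matrix.mul_apply,
    Matrix.of_apply, Matrix.kroneckerMap_apply, regroup_apply, Fintype.sum_prod_type,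
    Finset.mul_sum]
  rw [Finset.sum_comm]
  refine Finset.sum_congr rfl fun p _ => ?_
  rw [Finset.sum_congr rfl fun b _ => Finset.sum_comm, Finset.sum_comm]
  refine Finset.sum_congr rfl fun p' _ => Finset.sum_congr rfl fun b _ =>
    Finset.sum_congr rfl fun a _ => Finset.sum_congr rfl fun a' _ => ?_
  ring

theorem traceFst_regroup_iid {θ : P × S → ℂ} (hθ : IsUnitVector θ) (t : Sample n k) :
    traceFst (regroup _ S t (ketbra (iidVec (n + k) θ))) =
      tensorPow n (traceFst (ketbra θ)) := by
  classical
  ext b b'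
  -- The `k` sampled pairs are traced out completely and contribute the `k`-th power of the squared
  -- norm of `θ`.
  have h1 : ∑ p : Fin k → P, ∑ a : Fin k → S, ∏ i, (θ (p i, a i) * star (θ (p i, a i))) = 1 := by
    have h2 : ∀ p : Fin k → P, ∑ a : Fin k → S, ∏ i, (θ (p i, a i) * star (θ (p i, a i))) =
        ∏ i, ∑ s, θ (p i, s) * star (θ (p i, s)) := fun p => by rw [Fintype.prod_sum]
    simp only [h2]
    rw [← Fintype.prod_sum (fun (_ : Fin k) q => ∑ s, θ (q, s) * star (θ (q, s)))]
    refine Finset.prod_eq_one fun _ _ => ?_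
    rw [← hθ, dotProduct, Fintype.sum_prod_type]
    simp only [Pi.star_apply, mul_comm]
  simp only [traceFst, tensorPow, Matrix.of_apply, regroup_apply, ketbra, Matrix.vecMulVec_apply,
    Pi.star_apply, Fintype.sum_prod_type]
  rw [Fintype.prod_sum, ← (mergeEquiv P t).sum_comp, Fintype.sum_prod_type, Finset.sum_comm]
  refine Finset.sum_congr rfl fun q _ => ?_
  simp only [mergeEquiv, Equiv.coe_fn_mk, iidVec_mergeRegisters,
    mergeRegisters_samplePositions_inl, mergeRegisters_samplePositions_inr]
  refine Eq.trans ?_ (one_mul _)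
  rw [← h1, Finset.sum_mul]
  refine Finset.sum_congr rfl fun p _ => ?_
  rw [Finset.sum_mul]
  refine Finset.sum_congr rfl fun a _ => ?_
  simp only [star_mul', star_prod, Finset.prod_mul_distrib]
  ring

end Regroup

section Attack

variable {n k : ℕ} (M : Equiv.Perm (Fin n) → (Fin k → BB84) → (Fin k → Fin 2) →
  Op (Fin (n + k) → Fin 2))

/-- The effect for acceptance with record `π`, when Paul uses the POVM elements `M π c x` for the
answer `x` and the record `π`. -/
def acceptEffect (π : Equiv.Perm (Fin n)) : Op ((Fin (n + k) → Fin 2) × (Fin k → Fin 2)) :=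
  ((((2 : ℝ) ^ k)⁻¹ : ℝ) : ℂ) • ∑ c, ∑ x, M π c x ⊗ₖ bb84Proj c x

/-- The map of acceptance when Sam uses the fixed sample `t`. -/
def attackMap (t : Sample n k) : Op ((Fin (n + k) → Fin 2) × (Fin (n + k) → Fin 2)) →ₗ[ℂ]
    Op (Equiv.Perm (Fin n) × (Fin n → Fin 2)) :=
  (instrument (acceptEffect M)).comp (regroup _ (Fin 2) t)

variable {M}

theorem bb84Proj_posSemidef (c : Fin k → BB84) (x : Fin k → Fin 2) : (bb84Proj c x).PosSemidef :=
  ketbra_posSemidef _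

theorem acceptEffect_posSemidef (hM : ∀ π c x, (M π c x).PosSemidef) (π : Equiv.Perm (Fin n)) :
    (acceptEffect M π).PosSemidef :=
  (Matrix.posSemidef_sum _ fun c _ => Matrix.posSemidef_sum _ fun x _ =>
    (hM π c x).kronecker (bb84Proj_posSemidef c x)).smul
      (by rw [Complex.zero_le_real]; positivity)

theorem sum_acceptEffect : ∑ π, acceptEffect M π =
    ((((2 : ℝ) ^ k)⁻¹ : ℝ) : ℂ) • ∑ c, ∑ x, (∑ π, M π c x) ⊗ₖ bb84Proj c x := by
  simp only [acceptEffect, ← Finset.smul_sum]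
  congr 1
  rw [Finset.sum_comm]
  refine Finset.sum_congr rfl fun c _ => ?_
  rw [Finset.sum_comm]
  refine Finset.sum_congr rfl fun x _ => ?_
  ext u v
  simp [Matrix.sum_apply, Finset.sum_mul]

theorem one_sub_sum_acceptEffect_posSemidef (hM : ∀ π c x, (M π c x).PosSemidef)
    (hM1 : ∀ c, (1 - ∑ x, ∑ π, M π c x).PosSemidef) :
    (1 - ∑ π, acceptEffect M π).PosSemidef := by
  have hcard : (Finset.univ : Finset (Fin k → BB84)).card = 2 ^ k := by
    have : Fintype.card BB84 = 2 := rfl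
    simp [this]
  have h1 : (1 : Op ((Fin (n + k) → Fin 2) × (Fin k → Fin 2))) =
      ((((2 : ℝ) ^ k)⁻¹ : ℝ) : ℂ) • ∑ _c : Fin k → BB84, 1 := by
    rw [Finset.sum_const, hcard, ← Nat.cast_smul_eq_nsmul ℂ, smul_smul]
    push_cast
    rw [inv_mul_cancel₀ (by positivity), one_smul]
  rw [sum_acceptEffect, h1, ← smul_sub, ← Finset.sum_sub_distrib]
  refine (Matrix.posSemidef_sum _ fun c _ => ?_).smul (by rw [Complex.zero_le_real]; positivity)
  -- Rejection splits into Paul's measurement being incomplete and Sam's outcome differing from the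
  -- answer; both effects are positive.
  have h2 : (1 : Op ((Fin (n + k) → Fin 2) × (Fin k → Fin 2))) -
      ∑ x, (∑ π, M π c x) ⊗ₖ bb84Proj c x =
      (1 - ∑ x, ∑ π, M π c x) ⊗ₖ (1 : Op (Fin k → Fin 2)) +
        ∑ x, (∑ π, M π c x) ⊗ₖ (1 - bb84Proj c x) := by
    ext u v
    simp only [Matrix.sub_apply, Matrix.add_apply, Matrix.sum_apply, Matrix.kroneckerMap_apply,
      mul_sub, sub_mul, Finset.sum_sub_distrib,
      ← Matrix.one_kronecker_one (m := Fin (n + k) → Fin 2) (n := Fin k → Fin 2) (α := ℂ), Finset.sum_mul]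
    ring
  rw [h2]
  refine ((hM1 c).kronecker Matrix.PosSemidef.one).add (Matrix.posSemidef_sum _ fun x _ =>
    (Matrix.posSemidef_sum _ fun π _ => hM π c x).kronecker ?_)
  exact one_sub_posSemidef_of_isProj (bb84Proj_posSemidef c x).1 (bb84Proj_mul_self c x)

theorem attackMap_completelyPositive (hM : ∀ π c x, (M π c x).PosSemidef) (t : Sample n k) :
    IsCompletelyPositive (attackMap M t) :=
  isCompletelyPositive_comp_regroup t (instrument_completelyPositive (acceptEffect_posSemidef hM))

theorem attackMap_posSemidef (hM : ∀ π c x, (M π c x).PosSemidef) (t : Sample n k)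
    {X : Op ((Fin (n + k) → Fin 2) × (Fin (n + k) → Fin 2))} (hX : X.PosSemidef) :
    (attackMap M t X).PosSemidef :=
  instrument_posSemidef (acceptEffect_posSemidef hM) (regroup_posSemidef t hX)

theorem traceFst_attackMap (t : Sample n k)
    (X : Op ((Fin (n + k) → Fin 2) × (Fin (n + k) → Fin 2))) :
    traceFst (attackMap M t X) = filterOp (∑ π, acceptEffect M π) (regroup _ (Fin 2) t X) :=
  traceFst_instrument _ _

/-- The state after acceptance is dominated by the state of the unsampled registers. -/
theorem traceFst_regroup_sub_attackMap_posSemidef (hM : ∀ π c x, (M π c x).PosSemidef)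
    (hM1 : ∀ c, (1 - ∑ x, ∑ π, M π c x).PosSemidef) (t : Sample n k)
    {X : Op ((Fin (n + k) → Fin 2) × (Fin (n + k) → Fin 2))} (hX : X.PosSemidef) :
    (traceFst (regroup _ (Fin 2) t X) - traceFst (attackMap M t X)).PosSemidef := by
  rw [traceFst_attackMap, ← filterOp_one, ← filterOp_sub]
  exact filterOp_posSemidef (one_sub_sum_acceptEffect_posSemidef hM hM1) (regroup_posSemidef t hX)

theorem attackMap_traceNonincreasing (hM : ∀ π c x, (M π c x).PosSemidef)
    (hM1 : ∀ c, (1 - ∑ x, ∑ π, M π c x).PosSemidef) (t : Sample n k) :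
    IsTraceNonincreasing (attackMap M t) := by
  intro X hX
  have h := posSemidef_trace_re_nonneg (traceFst_regroup_sub_attackMap_posSemidef hM hM1 t hX)
  rw [Matrix.trace_sub, trace_traceFst, trace_traceFst, trace_regroup, Complex.sub_re] at h
  linarith

/-- Once the record is forgotten, `∑ π, M π c x` is a possibly incomplete measurement on `P^N`, to
which the guessing bound for a fixed sample applies. -/
theorem attackMap_iid_traceNorm_le (hM : ∀ π c x, (M π c x).PosSemidef)
    (hM1 : ∀ c, (1 - ∑ x, ∑ π, M π c x).PosSemidef) (t : Sample n k)
    {θ : Fin 2 × Fin 2 → ℂ} (hθ : IsUnitVector θ) {ε : ℝ} (hε : 0 < ε)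
    (hF : fidelity (traceFst (ketbra θ)) eprReference ^ 2 < 1 - ε) :
    traceNorm (attackMap M t (ketbra (iidVec (n + k) θ))) ≤ guessBound ε ^ k := by
  rw [traceNorm_of_posSemidef (attackMap_posSemidef hM t (ketbra_posSemidef _)), ← trace_traceFst,
    traceFst_attackMap, sum_acceptEffect, filterOp_smul, Matrix.trace_smul, smul_eq_mul,
    Complex.re_ofReal_mul]
  simp only [filterOp_sum, Matrix.trace_sum, trace_filterOp_kronecker_regroup, Complex.re_sum]
  refine average_functional_iid_le hθ hε hF t
    (L := fun c x => (Matrix.traceLinearMap _ ℂ ℂ).comp (LinearMap.mulLeft ℂ (∑ π, M π c x)))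
    (fun c x Y hY => posSemidef_trace_mul_re_nonneg
      (Matrix.posSemidef_sum _ fun π _ => hM π c x) hY) fun c Y hY => ?_
  have h := posSemidef_trace_mul_re_nonneg (hM1 c) hY
  rw [Matrix.sub_mul, Matrix.one_mul, Matrix.trace_sub, Complex.sub_re, Finset.sum_mul,
    Matrix.trace_sum, Complex.re_sum] at h
  change ∑ x, ((∑ π, M π c x) * Y).trace.re ≤ _
  linarith

end Attack

/-! ### Symmetrized attacks -/

theorem bb84Proj_comp {k : ℕ} (κ : Equiv.Perm (Fin k)) (c : Fin k → BB84) (x a a' : Fin k → Fin 2) :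
    bb84Proj (c ∘ κ) (x ∘ κ) (a ∘ κ) (a' ∘ κ) = bb84Proj c x a a' := by
  have h : ∀ s : Fin k → Fin 2, ∏ i, bb84Vec ((c ∘ κ) i) ((x ∘ κ) i) ((s ∘ κ) i) =
      ∏ i, bb84Vec (c i) (x i) (s i) := fun s =>
    Equiv.prod_comp κ fun i => bb84Vec (c i) (x i) (s i)
  simp only [bb84Proj, ketbra, Matrix.vecMulVec_apply, Pi.star_apply, h]

/-- Permuting the state and sampling at `t₀` amounts to sampling at `t`, with bases and answers
reordered by `κ` and the output permuted by `π`. -/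
theorem sampledTrace_samplePerm {n k : ℕ} (t₀ t : Sample n k) (κ : Equiv.Perm (Fin k))
    (π : Equiv.Perm (Fin n)) (c : Fin k → BB84) (x : Fin k → Fin 2)
    (Y : Op (Fin (n + k) → Fin 2)) (b b' : Fin n → Fin 2) :
    sampledTrace t₀ (bb84Proj c x)
      (Y.submatrix (fun s => s ∘ samplePerm t₀ t κ π) fun s => s ∘ samplePerm t₀ t κ π) b b' =
    sampledTrace t (bb84Proj (c ∘ κ) (x ∘ κ)) Y (b ∘ π) (b' ∘ π) := by
  let e : (Fin k → Fin 2) ≃ (Fin k → Fin 2) := κ.symm.arrowCongr (Equiv.refl _)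
  have he : ∀ a, e a = a ∘ κ := fun a => rfl
  simp only [sampledTrace, Matrix.of_apply, Matrix.submatrix_apply, mergeRegisters_comp_samplePerm]
  refine Eq.trans (Finset.sum_congr rfl fun a _ => ?_) (e.sum_comp _)
  refine Eq.trans (Finset.sum_congr rfl fun a' _ => ?_) (e.sum_comp _)
  rw [he, he, bb84Proj_comp]

theorem sampledTrace_sum {S ι : Type} [Fintype S] {n k : ℕ} (t : Sample n k) (F : Op (Fin k → S))
    (s : Finset ι) (Y : ι → Op (Fin (n + k) → S)) :
    sampledTrace t F (∑ i ∈ s, Y i) = ∑ i ∈ s, sampledTrace t F (Y i) := by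
  ext b b'
  simp only [sampledTrace, Matrix.of_apply, Matrix.sum_apply, Finset.mul_sum]
  rw [Finset.sum_congr rfl fun x _ => Finset.sum_comm, Finset.sum_comm]

theorem sampledTrace_smul {S : Type} [Fintype S] {n k : ℕ} (t : Sample n k) (F : Op (Fin k → S))
    (z : ℂ) (Y : Op (Fin (n + k) → S)) :
    sampledTrace t F (z • Y) = z • sampledTrace t F Y := by
  ext b b'
  simp only [sampledTrace, Matrix.of_apply, Matrix.smul_apply, smul_eq_mul, Finset.mul_sum,
    mul_left_comm z]

/-- The transpose trick: an effect on the purifying half acts on the other half through its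
transpose. -/
theorem filterOp_canonicalPurification {a : Type} [Fintype a] {T : Op a} (hT : T.IsHermitian)
    (M : Op a) : filterOp Mᵀ (ketbra (canonicalPurification T)) = T * M * T := by
  ext s s'
  simp only [filterOp, ketbra, Matrix.of_apply, Matrix.vecMulVec_apply, Pi.star_apply,
    canonicalPurification, Matrix.mul_apply, Matrix.transpose_apply, Finset.sum_mul]
  refine Finset.sum_congr rfl fun p _ => Finset.sum_congr rfl fun p' _ => ?_
  rw [hT.apply]
  ring

/-- Every decomposition of the reduced state of a purification arises from a measurement. -/
theorem mul_pseudoInverse_mul {a : Type} [Fintype a] [DecidableEq a] {T G σ τ : Op a}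
    (hTG : T * G = G * T) (hP : (T * G).IsHermitian) (hσ : σ * (T * G) = σ)
    (hτ : τ.PosSemidef) (hd : (σ - τ).PosSemidef) : T * (G * τ * G) * T = τ := by
  have h1 : τ * (1 - T * G) = 0 :=
    mul_eq_zero_of_dominated hτ hd (by rw [mul_sub, mul_one, hσ, sub_self])
  have h2 : τ * (T * G) = τ := by
    rw [mul_sub, mul_one, sub_eq_zero] at h1
    exact h1.symm
  have h3 : (T * G) * τ = τ := by
    have := congrArg Matrix.conjTranspose h2
    rwa [Matrix.conjTranspose_mul, hP.eq, hτ.1.eq] at this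
  calc T * (G * τ * G) * T = (T * G) * τ * (G * T) := by simp only [Matrix.mul_assoc]
    _ = τ := by rw [← hTG, h3, h2]

theorem exists_attackMap {n k : ℕ} {R : Type} [Fintype R]
    (A : Strategy R (Fin k → BB84) (Fin k → Fin 2) n k) {ρ : Op (R × (Fin (n + k) → Fin 2))}
    (hρ : ρ.PosSemidef) (t₀ : Sample n k) :
    ∃ M : Equiv.Perm (Fin n) → (Fin k → BB84) → (Fin k → Fin 2) → Op (Fin (n + k) → Fin 2),
      (∀ π c x, (M π c x).PosSemidef) ∧ (∀ c, (1 - ∑ x, ∑ π, M π c x).PosSemidef) ∧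
      ∃ ψ : (Fin (n + k) → Fin 2) × (Fin (n + k) → Fin 2) → ℂ, IsSymmetricVector ψ ∧
        traceFst (ketbra ψ) = symmetrize (traceFst ρ) ∧
        symmetrizeWithRecord (accOutput (eprLOCC n k) A ρ) = attackMap M t₀ (ketbra ψ) := by
  set σ := symmetrize (traceFst ρ) with hσdef
  have hσ : σ.PosSemidef := symmetrize_posSemidef (traceFst_posSemidef hρ)
  obtain ⟨T, G, hT, hG, hTT, hTG, hPP, hP, hσP, hGσG, hcomm⟩ := exists_sqrt_pseudoInverse hσ
  -- The unnormalized state of `S^N` when the permutation `(t, κ, π)` is drawn and Sam's bases at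
  -- `t₀` are `c`: in the original order Paul receives `(t, c ∘ κ)` and answers `x ∘ κ`.
  let τ : Sample n k → Equiv.Perm (Fin k) → Equiv.Perm (Fin n) → (Fin k → BB84) →
      (Fin k → Fin 2) → Op (Fin (n + k) → Fin 2) := fun t κ π c x =>
    ((n + k).factorial : ℂ)⁻¹ • (outcomeOp A t (c ∘ κ) (x ∘ κ) ρ).submatrix
      (fun s => s ∘ samplePerm t₀ t κ π) fun s => s ∘ samplePerm t₀ t κ π
  have hτ : ∀ t κ π c x, (τ t κ π c x).PosSemidef := fun t κ π c x =>
    ((outcomeOp_posSemidef A t _ _ hρ).submatrix _).smul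
      (by rw [inv_nonneg]; exact Nat.cast_nonneg _)
  -- Summed over his answers, Paul's operation does not affect `S^N`; what remains is the average
  -- over all permutations, the same for every `c`.
  have hsumτ : ∀ c, ∑ x, ∑ π, ∑ t, ∑ κ, τ t κ π c x = σ := by
    intro c
    have hx : ∀ t κ π, ∑ x, τ t κ π c x = ((n + k).factorial : ℂ)⁻¹ • (traceFst ρ).submatrix
        (fun s => s ∘ samplePerm t₀ t κ π) fun s => s ∘ samplePerm t₀ t κ π := by
      intro t κ π
      rw [← Finset.smul_sum, ← sum_outcomeOp A t (c ∘ κ) ρ]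
      congr 1
      ext s s'
      simp only [Matrix.sum_apply, Matrix.submatrix_apply]
      exact Equiv.sum_comp (κ.symm.arrowCongr (Equiv.refl (Fin 2))) fun x =>
        outcomeOp A t (c ∘ κ) x ρ (s ∘ samplePerm t₀ t κ π) (s' ∘ samplePerm t₀ t κ π)
    calc ∑ x, ∑ π, ∑ t, ∑ κ, τ t κ π c x = ∑ t, ∑ κ, ∑ π, ∑ x, τ t κ π c x := by
          rw [Finset.sum_comm, Finset.sum_congr rfl fun π _ => Finset.sum_comm, Finset.sum_comm]
          refine Finset.sum_congr rfl fun t _ => ?_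
          rw [Finset.sum_congr rfl fun π _ => Finset.sum_comm, Finset.sum_comm]
      _ = σ := by
          simp only [hx]
          ext s s'
          rw [hσdef, symmetrize_apply, ← sum_samplePerm t₀]
          simp only [Matrix.sum_apply, Matrix.smul_apply, Matrix.submatrix_apply, smul_eq_mul,
            Finset.mul_sum]
  have hdom : ∀ t κ π c x, (σ - τ t κ π c x).PosSemidef := by
    intro t κ π c x
    let g : (Fin k → Fin 2) × Equiv.Perm (Fin n) × Sample n k × Equiv.Perm (Fin k) →
        Op (Fin (n + k) → Fin 2) := fun u => τ u.2.2.1 u.2.2.2 u.2.1 c u.1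
    have hg : ∑ u, g u = σ := by
      rw [← hsumτ c]
      simp only [g, Fintype.sum_prod_type]
    rw [← hg, show τ t κ π c x = g (x, π, t, κ) from rfl,
      ← Finset.sum_erase_eq_sub (Finset.mem_univ (x, π, t, κ))]
    exact Matrix.posSemidef_sum _ fun u _ => hτ _ _ _ _ _
  -- The pretty good measurement of the decomposition, transposed to the purifying register. Its
  -- total is the transposed support projector of `σ`, so it may be incomplete.
  let M : Equiv.Perm (Fin n) → (Fin k → BB84) → (Fin k → Fin 2) → Op (Fin (n + k) → Fin 2) :=
    fun π c x => ∑ t, ∑ κ, (G * τ t κ π c x * G)ᵀ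
  refine ⟨M, ?_, ?_, canonicalPurification T, ?_, ?_, ?_⟩
  · intro π c x
    refine Matrix.posSemidef_sum _ fun t _ => Matrix.posSemidef_sum _ fun κ _ => ?_
    have := (hτ t κ π c x).mul_mul_conjTranspose_same G
    rw [hG.eq] at this
    exact this.transpose
  · intro c
    have h1 : ∑ x, ∑ π, M π c x = (T * G)ᵀ := by
      rw [← hGσG, ← hsumτ c]
      simp only [M, Finset.mul_sum, Finset.sum_mul, Matrix.transpose_sum]
    have h2 := (one_sub_posSemidef_of_isProj hP hPP).transpose
    rwa [Matrix.transpose_sub, Matrix.transpose_one, ← h1] at h2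
  · exact canonicalPurification_symmetric fun ν => hcomm _ (symmetrize_comm_permOp _ ν)
  · rw [traceFst_canonicalPurification hT, hTT]
  · have hfilter : ∀ π c x, filterOp (M π c x) (ketbra (canonicalPurification T)) =
        ∑ t, ∑ κ, τ t κ π c x := by
      intro π c x
      simp only [M, filterOp_sum, filterOp_canonicalPurification hT]
      exact Finset.sum_congr rfl fun t _ => Finset.sum_congr rfl fun κ _ =>
        mul_pseudoInverse_mul hTG hP hσP (hτ t κ π c x) (hdom t κ π c x)
    ext ⟨π, b⟩ ⟨π', b'⟩
    rw [symmetrizeWithRecord_apply, attackMap, LinearMap.comp_apply, instrument_apply]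
    split_ifs with h
    · simp only [acceptEffect, filterOp_smul, filterOp_sum, filterOp_kronecker_regroup, hfilter]
      let f : Sample n k → (Fin k → BB84) → (Fin k → Fin 2) → ℂ := fun t c x =>
        sampledTrace t (bb84Proj c x) (outcomeOp A t c x ρ) (b ∘ π) (b' ∘ π)
      have hf : ∀ c x, sampledTrace t₀ (bb84Proj c x) (∑ t, ∑ κ, τ t κ π c x) b b' =
          ∑ t, ∑ κ : Equiv.Perm (Fin k), ((n + k).factorial : ℂ)⁻¹ * f t (c ∘ κ) (x ∘ κ) := by
        intro c x
        simp only [sampledTrace_sum, Matrix.sum_apply, τ, sampledTrace_smul, Matrix.smul_apply,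
          sampledTrace_samplePerm, smul_eq_mul, f]
      -- Uniformity of the bases makes the order of the sampled positions irrelevant, so the sum
      -- over `κ` only contributes a factor `k!`.
      have hκ : ∀ t (κ : Equiv.Perm (Fin k)), ∑ c, ∑ x, f t (c ∘ κ) (x ∘ κ) =
          ∑ c, ∑ x, f t c x := by
        intro t κ
        refine Eq.trans (Finset.sum_congr rfl fun c _ => ?_)
          (Equiv.sum_comp (κ.symm.arrowCongr (Equiv.refl BB84)) fun c => ∑ x, f t c x)
        exact Equiv.sum_comp (κ.symm.arrowCongr (Equiv.refl (Fin 2))) fun x => f t (c ∘ κ) x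
      have hsum : ∑ c, ∑ x, ∑ t, ∑ κ : Equiv.Perm (Fin k),
          ((n + k).factorial : ℂ)⁻¹ * f t (c ∘ κ) (x ∘ κ) =
          ((n + k).factorial : ℂ)⁻¹ * (k.factorial * ∑ t, ∑ c, ∑ x, f t c x) := by
        calc _ = ∑ t, ∑ κ : Equiv.Perm (Fin k), ∑ c, ∑ x,
              ((n + k).factorial : ℂ)⁻¹ * f t (c ∘ κ) (x ∘ κ) := by
              rw [Finset.sum_congr rfl fun c _ => Finset.sum_comm, Finset.sum_comm]
              refine Finset.sum_congr rfl fun t _ => ?_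
              rw [Finset.sum_congr rfl fun c _ => Finset.sum_comm, Finset.sum_comm]
          _ = _ := by
              simp only [← Finset.mul_sum, hκ, Finset.sum_const, Finset.card_univ,
                Fintype.card_perm, Fintype.card_fin, nsmul_eq_mul]
      have hfact : (n.factorial : ℂ)⁻¹ * ((n + k).choose k : ℂ)⁻¹ =
          ((n + k).factorial : ℂ)⁻¹ * k.factorial := by
        have h1 : ((n + k).choose k : ℂ) * k.factorial * n.factorial = (n + k).factorial := by
          exact_mod_cast (by simpa using
            Nat.choose_mul_factorial_mul_factorial (Nat.le_add_left k n))
        have h2 : (n.factorial : ℂ) ≠ 0 := Nat.cast_ne_zero.mpr n.factorial_ne_zero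
        have h3 : (k.factorial : ℂ) ≠ 0 := Nat.cast_ne_zero.mpr k.factorial_ne_zero
        have h4 : ((n + k).choose k : ℂ) ≠ 0 :=
          Nat.cast_ne_zero.mpr (Nat.choose_pos (Nat.le_add_left k n)).ne'
        rw [← h1]
        field_simp
      rw [accOutput_eprLOCC]
      simp only [Matrix.smul_apply, Matrix.sum_apply, smul_eq_mul]
      simp only [hf]
      rw [hsum]
      push_cast
      linear_combination ((2 : ℂ) ^ k)⁻¹ * (∑ t, ∑ c, ∑ x, f t c x) * hfact
    · rfl

theorem eprLOCC_isPermutationInvariant : IsPermutationInvariant eprLOCC eprReference := by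
  intro β hβ
  -- Chosen so that `guessBound ε ^ k ≤ exp (-(rate ε * N))`: the logarithm is negative and `k ≥
  -- βN`.
  refine ⟨fun ε => -(β * Real.log (guessBound ε)), fun ε hε => ?_, ?_⟩
  · have := Real.log_neg (guessBound_pos ε) (guessBound_lt_one hε)
    nlinarith
  intro n k hk R _ A ρ hρ
  obtain ⟨t₀⟩ : Nonempty (Sample n k) := by
    rw [← Fintype.card_pos_iff, card_sample]
    exact Nat.choose_pos (Nat.le_add_left k n)
  obtain ⟨M, hM, hM1, hψ⟩ := exists_attackMap A hρ.1 t₀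
  refine ⟨attackMap M t₀, attackMap_completelyPositive hM t₀,
    attackMap_traceNonincreasing hM hM1 t₀, hψ, fun ε hε θ hθ hF => ?_, fun θ hθ => ?_⟩
  · refine (attackMap_iid_traceNorm_le hM hM1 t₀ hθ hε hF).trans ?_
    have hlog := Real.log_neg (guessBound_pos ε) (guessBound_lt_one hε)
    rw [← Real.exp_log (guessBound_pos ε), ← Real.exp_nat_mul, Real.exp_le_exp]
    linarith [mul_le_mul_of_nonpos_right hk hlog.le]
  · rw [← traceFst_regroup_iid hθ t₀]
    exact traceFst_regroup_sub_attackMap_posSemidef hM hM1 t₀ (ketbra_posSemidef _)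

end

end QSampling

theorem mainTheorem6 :
    QSampling.IsPermutationInvariant QSampling.eprLOCC QSampling.eprReference ∧
    ∀ ε : ℝ, 0 < ε → ∃ γ : ℝ, 0 ≤ γ ∧ γ < 1 ∧
      ∀ θ : Fin 2 × Fin 2 → ℂ, QSampling.IsUnitVector θ →
        QSampling.fidelity (QSampling.traceFst (QSampling.ketbra θ)) QSampling.eprReference ^ 2
          < 1 - ε →
        (∀ E : QSampling.BB84 → Fin 2 → QSampling.Op (Fin 2),
          (∀ c, QSampling.IsPOVM (E c)) → QSampling.guessProb E θ ≤ γ) ∧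
        ∀ (n k : ℕ)
          (A : QSampling.Strategy (Fin (n + k) → Fin 2) (Fin k → QSampling.BB84)
            (Fin k → Fin 2) n k),
          (QSampling.accOutput (QSampling.eprLOCC n k) A
            (QSampling.ketbra (QSampling.iidVec (n + k) θ))).trace.re ≤ γ ^ k :=
  ⟨QSampling.eprLOCC_isPermutationInvariant, fun ε hε =>
    ⟨QSampling.guessBound ε, (QSampling.guessBound_pos ε).le, QSampling.guessBound_lt_one hε,
      fun _ hθ hF => ⟨fun _ hE => QSampling.guessProb_le hθ hε hF hE,
        fun _ _ A => QSampling.accOutput_iid_trace_le hθ hε hF A⟩⟩⟩
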